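/- Let $0<H<1$ and let $X=\{X_t : t\ge 0\}$ be a fractional Brownian motion with Hurst parameter $H$ on a probability space $(\Omega,\mathcal F,\mathbb P)$, i.e. a (jointly measurable) centered Gaussian process with $\mathbb E[X_sX_t]=\tfrac12\left(s^{2H}+t^{2H}-|t-s|^{2H}\right)$. For $\varepsilon>0$ put $\phi_\varepsilon(x)=(2\pi\varepsilon)^{-1/2}e^{-x^2/(2\varepsilon)}$, and let $\phi_\varepsilon^{(\ell)}$ be its $\ell$-th derivative. Let $\ell\ge 0$ be an integer such that $H<\frac1{2\ell+1}$. Then: 1. For every $t\ge 0$ and $\lambda\in\mathbb R$, the random variables $\int_0^t\phi_\varepsilon^{(\ell)}(X_s-\lambda)\,ds$ converge in $L^2(\Omega)$, as $\varepsilon\downarrow 0$, to a limit $L^{(\ell)}_t(\lambda)$. (As $H<\frac1{2\ell+1}\le\frac1{2k+1}$, the limits $L^{(k)}_t(\lambda)$ then exist for all $0\le k\le \ell$.) 2. For every $t\ge 0$ and $\lambda\in\mathbb R$, $$L^{(\ell)}_t(\lambda)=\lim_{N\to\infty}\frac1{2\pi}\int_{-N}^{N}\int_0^t(i\xi)^\ell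 e^{i\xi(X_s-\lambda)}\,ds\,d\xi\quad\text{in }L^2(\Omega).$$ 3. If $\ell\ge 1$, then for every $t\ge 0$ and $\lambda\in\mathbb R$, $$-L^{(\ell)}_t(\lambda)=\lim_{h\to 0}\frac1h\left(L^{(\ell-1)}_t(\lambda+h)-L^{(\ell-1)}_t(\lambda)\right)\quad\text{in }L^2(\Omega).$$ 4. For every $\lambda\in\mathbb R$ and every real $p>1$ there is a constant $C$ such that, for all $0\le u<v$, $$\mathbb E\left|L^{(\ell)}_v(\lambda)-L^{(\ell)}_u(\lambda)\right|^{2p}\le C\,|u-v|^{2p(1-H(\ell+1))}.$$ 5. For every $\lambda\in\mathbb R$, the process $\{L^{(\ell)}_t(\lambda):t\ge 0\}$ has a modification whose trajectories are, for every $0<\gamma<1-H(\ell+1)$, Hölder continuous of order $\gamma$ on every interval $[0,T]$, $T>0$. -/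

import Mathlib

open MeasureTheory ProbabilityTheory Filter Topology
open scoped NNReal ENNReal

noncomputable section

/-- `X` is a fractional Brownian motion with Hurst parameter `H` under `P`: a centered Gaussian
process indexed by `[0, ∞)` with covariance `E[X_s X_t] = (s^{2H} + t^{2H} - |t - s|^{2H}) / 2`.

The last field is the joint measurability in `(s, ω)` (up to null sets) that is needed to speak of
the pathwise integrals `∫₀ᵗ f (X_s) ds` as random variables. It is weaker than almost sure
continuity of the paths. (For `s < 0` the map below is just `X 0`, so that the field
only concerns times `s ≥ 0`.) -/
structure IsFractionalBrownianMotion {Ω : Type*} [MeasurableSpace Ω] (H : ℝ)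
    (X : ℝ≥0 → Ω → ℝ) (P : Measure Ω) : Prop where
  isGaussianProcess : IsGaussianProcess X P
  mean_eq_zero : ∀ t : ℝ≥0, ∫ ω, X t ω ∂P = 0
  covariance_eq : ∀ s t : ℝ≥0, ∫ ω, X s ω * X t ω ∂P =
    1 / 2 * ((s : ℝ) ^ (2 * H) + (t : ℝ) ^ (2 * H) - |(t : ℝ) - (s : ℝ)| ^ (2 * H))
  aemeasurable_joint :
    AEMeasurable (fun q : ℝ × Ω => X q.1.toNNReal q.2) ((volume : Measure ℝ).prod P)

/-- The Gaussian kernel `φ_ε(x) = (2πε)^{-1/2} exp(-x² / (2ε))`. -/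
def gaussKernel (ε : ℝ) (x : ℝ) : ℝ :=
  (2 * Real.pi * ε) ^ (-(1 / 2 : ℝ)) * Real.exp (-(1 / (2 * ε)) * x ^ 2)

/-- The random variable `∫₀ᵗ φ_ε^{(ℓ)}(X_s - x) ds`. -/
def localTimeDerivApprox {Ω : Type*} (X : ℝ≥0 → Ω → ℝ) (ℓ : ℕ) (ε : ℝ) (t : ℝ≥0) (x : ℝ)
    (ω : Ω) : ℝ :=
  ∫ s in (0 : ℝ)..(t : ℝ), iteratedDeriv ℓ (gaussKernel ε) (X s.toNNReal ω - x)

/-- The truncated Fourier integral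
`(2π)⁻¹ ∫_{-N}^{N} ∫₀ᵗ (iξ)^ℓ exp(iξ (X_s - x)) ds dξ`. -/
def localTimeDerivFourier {Ω : Type*} (X : ℝ≥0 → Ω → ℝ) (ℓ : ℕ) (N : ℝ) (t : ℝ≥0) (x : ℝ)
    (ω : Ω) : ℂ :=
  1 / (2 * (Real.pi : ℂ)) * ∫ ξ in (-N)..N, ∫ s in (0 : ℝ)..(t : ℝ),
    (Complex.I * (ξ : ℂ)) ^ ℓ *
      Complex.exp (Complex.I * (ξ : ℂ) * ((X s.toNNReal ω - x : ℝ) : ℂ))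

/-- `F i → Y` in `L²(Ω)` along the filter `l`; the variables `F i` (eventually) and `Y` belong to
`L²(Ω)`. -/
def TendstoInL2 {Ω ι E : Type*} [MeasurableSpace Ω] [NormedAddCommGroup E] (P : Measure Ω)
    (F : ι → Ω → E) (l : Filter ι) (Y : Ω → E) : Prop :=
  (∀ᶠ i in l, MemLp (F i) 2 P) ∧ MemLp Y 2 P ∧
    Tendsto (fun i => eLpNorm (fun ω => F i ω - Y ω) 2 P) l (𝓝 0)

/-- The process `Z` is a modification of the process `Y`. -/
def IsModificationOf {Ω : Type*} [MeasurableSpace Ω] (P : Measure Ω) (Z Y : ℝ≥0 → Ω → ℝ) : Prop :=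
  ∀ t, Measurable (Z t) ∧ Z t =ᵐ[P] Y t

/-- The path `f : [0, ∞) → ℝ` is Hölder continuous of order `γ` on every interval `[0, T]`. -/
def IsLocallyHolder (γ : ℝ≥0) (f : ℝ≥0 → ℝ) : Prop :=
  ∀ T : ℝ≥0, ∃ K : ℝ≥0, HolderOnWith K γ f (Set.Icc 0 T)

end

/-!
Every random variable whose limit is taken is, almost surely, a Fourier integral
`F_k = ∫_{(u, v]} ∫ k(ξ) e^{iξX_s} dξ ds` (`occupationFourier`) with an integrable multiplier `k`
such that `k(-ξ)` is the conjugate of `k(ξ)`, or, for the difference quotients, a limit of such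
integrals. The mollified variables have `k(ξ) = (2π)⁻¹ (iξ)^ℓ e^{-iξλ} e^{-εξ²/2}`, the truncated
Fourier integrals have the same symbol with an indicator of `[-N, N]` in place of the Gaussian
factor.

For such `k` the variable `F_k` is real, and Fubini's theorem with the Gaussian characteristic
function bounds its even moments by `∫ ∏ⱼ |k(ξⱼ)| exp(-Var(∑ⱼ ξⱼ X_{sⱼ}) / 2) ds dξ`, the
`momentIntegral` of `|k|` (`lintegral_enorm_occupationFourier_pow_le`). The heart of the matter is
that for `|k(ξ)| = |ξ|^ℓ` this integral of order `m` is finite, and at most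
`C (v - u)^{m(1 - H(ℓ+1))}` (`exists_momentIntegral_le`).

This rests on local nondeterminism: for `u ≤ s₁ ≤ ⋯ ≤ sₘ` and `ηⱼ = ξⱼ + ⋯ + ξₘ`, with `s₀ = u`,
`Var(∑ⱼ ξⱼ X_{sⱼ}) ≥ c ∑ⱼ ηⱼ² (sⱼ - sⱼ₋₁)^{2H}` (`exists_mul_chainForm_le_fbmForm`). By induction
and stationarity of the increments it suffices to treat the first term. For that one, the variance
is a weighted `L²`-norm of `∑ⱼ ξⱼ (e^{2πisⱼx} - 1)`; after scaling to times at least `1`, this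
function is paired with the Fourier transform of a bump function supported in `(-1, 1)`, which
annihilates all the exponentials and leaves `-∑ⱼ ξⱼ`. With the variance replaced by this lower
bound, the moment integral is estimated by integrating out the smallest time and its frequency
recursively (`exists_sortedIntegral_succ_le`). The most singular factor is `(s - u)^{-H(2ℓ+1)}`,
integrable exactly if `H < 1 / (2ℓ + 1)`.

With these bounds, convergence in `L²` along the mollification, the truncation and the difference
quotients in space is dominated convergence in the moment integral of order two
(`tendsto_momentIntegral`, `exists_L2_limit_occupationFourier`). The moments of the increments in
time follow by Fatou's lemma (`eLpNorm_increment_le`), and the Hölder modification by the chaining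
argument of Kolmogorov (`exists_holder_modification`). -/

/-! ### Spectral representation of the covariance -/

/-- The covariance quadratic form of fractional Brownian motion, that is, the variance of
`∑ i, ξ i * X (t i)`. The times are real numbers and enter through `|t i|`, which is the covariance
of the two-sided process, so that the form also makes sense for arbitrary real times. -/
noncomputable def fbmForm {ι : Type*} [Fintype ι] (H : ℝ) (t ξ : ι → ℝ) : ℝ :=
  ∑ i, ∑ j, ξ i * ξ j *
    (1 / 2 * (|t i| ^ (2 * H) + |t j| ^ (2 * H) - |t j - t i| ^ (2 * H)))

/-- The character `x ↦ e^{2πitx}`, in the normalization of Mathlib's Fourier transform. -/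
noncomputable def wave (t x : ℝ) : ℂ := Complex.exp ((2 * Real.pi * (t * x) : ℝ) * Complex.I)

lemma norm_wave (t x : ℝ) : ‖wave t x‖ = 1 := Complex.norm_exp_ofReal_mul_I _

lemma wave_add (s t x : ℝ) : wave (s + t) x = wave s x * wave t x := by
  simp only [wave, ← Complex.exp_add]; congr 1; push_cast; ring

lemma continuous_wave (t : ℝ) : Continuous (wave t) := by unfold wave; fun_prop

lemma wave_re (t x : ℝ) : (wave t x).re = Real.cos (2 * Real.pi * (t * x)) :=
  Complex.exp_ofReal_mul_I_re _

lemma wave_im (t x : ℝ) : (wave t x).im = Real.sin (2 * Real.pi * (t * x)) :=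
  Complex.exp_ofReal_mul_I_im _

/-- Near `0` the weight is compensated by `1 - cos (2πx) = O(x²)`, and `1 - 2H > -1`; at infinity
`-1 - 2H < -1`. -/
lemma integrable_one_sub_cos_mul_rpow {H : ℝ} (hH0 : 0 < H) (hH1 : H < 1) :
    Integrable fun x : ℝ => (1 - Real.cos (2 * Real.pi * x)) * |x| ^ (-1 - 2 * H) := by
  have key : IntegrableOn (fun x : ℝ => (1 - Real.cos (2 * Real.pi * x)) * |x| ^ (-1 - 2 * H))
      (Set.Ioi 0) := by
    rw [← Set.Ioc_union_Ioi_eq_Ioi (zero_le_one (α := ℝ))]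
    refine IntegrableOn.union ?_ ?_
    · have h1 : IntegrableOn (fun x : ℝ => (2 * Real.pi) ^ 2 / 2 * x ^ (1 - 2 * H))
          (Set.Ioc 0 1) := by
        have := intervalIntegral.intervalIntegrable_rpow' (a := 0) (b := 1)
          (r := 1 - 2 * H) (by linarith)
        rw [intervalIntegrable_iff_integrableOn_Ioc_of_le zero_le_one] at this
        exact this.const_mul _
      refine Integrable.mono' h1 (by fun_prop) ?_
      filter_upwards [ae_restrict_mem measurableSet_Ioc] with x hx
      rw [abs_of_pos hx.1, Real.norm_of_nonneg
        (mul_nonneg (sub_nonneg.2 (Real.cos_le_one _)) (Real.rpow_nonneg hx.1.le _))]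
      have h2 : x ^ (1 - 2 * H) = x ^ 2 * x ^ (-1 - 2 * H) := by
        rw [← Real.rpow_natCast, ← Real.rpow_add hx.1]; congr 1; push_cast; ring
      rw [h2, ← mul_assoc]
      refine mul_le_mul_of_nonneg_right ?_ (Real.rpow_nonneg hx.1.le _)
      have := Real.one_sub_sq_div_two_le_cos (x := 2 * Real.pi * x)
      nlinarith
    · have h1 : IntegrableOn (fun x : ℝ => 2 * x ^ (-1 - 2 * H)) (Set.Ioi 1) :=
        (integrableOn_Ioi_rpow_of_lt (by linarith) one_pos).const_mul _
      refine Integrable.mono' h1 (by fun_prop) ?_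
      filter_upwards [ae_restrict_mem measurableSet_Ioi] with x hx
      have hx0 : 0 < x := one_pos.trans hx
      rw [abs_of_pos hx0, Real.norm_of_nonneg
        (mul_nonneg (sub_nonneg.2 (Real.cos_le_one _)) (Real.rpow_nonneg hx0.le _))]
      exact mul_le_mul_of_nonneg_right (by linarith [Real.neg_one_le_cos (2 * Real.pi * x)])
        (Real.rpow_nonneg hx0.le _)
  have key' : IntegrableOn (fun x : ℝ => (1 - Real.cos (2 * Real.pi * x)) * |x| ^ (-1 - 2 * H))
      (Set.Iic 0) := by
    rw [← integrableOn_Ici_iff_integrableOn_Ioi] at key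
    have := (integrable_indicator_iff measurableSet_Ici).2 key |>.comp_neg
    rw [← integrable_indicator_iff measurableSet_Iic]
    refine this.congr (ae_of_all _ fun x => ?_)
    by_cases hx : x ≤ 0
    · simp [Set.indicator, hx]
    · simp [Set.indicator, hx]
  have := key'.union key
  rwa [Set.Iic_union_Ioi, integrableOn_univ] at this

/-- The normalising constant `∫ (1 - cos (2πx)) |x|^{-1-2H} dx` of the spectral representation. -/
noncomputable def spectralConst (H : ℝ) : ℝ :=
  ∫ x : ℝ, (1 - Real.cos (2 * Real.pi * x)) * |x| ^ (-1 - 2 * H)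

lemma integrable_one_sub_cos_mul_rpow_scaled {H : ℝ} (hH0 : 0 < H) (hH1 : H < 1) (t : ℝ) :
    Integrable (fun x : ℝ => (1 - Real.cos (2 * Real.pi * (t * x))) * |x| ^ (-1 - 2 * H)) ∧
    ∫ x : ℝ, (1 - Real.cos (2 * Real.pi * (t * x))) * |x| ^ (-1 - 2 * H) =
      spectralConst H * |t| ^ (2 * H) := by
  rcases eq_or_ne t 0 with rfl | ht
  · have h : (2 * H) ≠ 0 := by positivity
    simp [Real.zero_rpow h]
  have ht' : 0 < |t| := abs_pos.2 ht
  have e : (fun x : ℝ => (1 - Real.cos (2 * Real.pi * (t * x))) * |x| ^ (-1 - 2 * H)) =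
      fun x => |t| ^ (1 + 2 * H) *
        ((1 - Real.cos (2 * Real.pi * (t * x))) * |t * x| ^ (-1 - 2 * H)) := by
    ext x
    rw [abs_mul, Real.mul_rpow (abs_nonneg _) (abs_nonneg _)]
    have : |t| ^ (1 + 2 * H) * |t| ^ (-1 - 2 * H) = 1 := by
      rw [← Real.rpow_add ht']; ring_nf; simp
    linear_combination (-(1 - Real.cos (2 * Real.pi * (t * x))) * |x| ^ (-1 - 2 * H)) * this
  have hi := integrable_one_sub_cos_mul_rpow hH0 hH1
  constructor
  · rw [e]
    exact (((integrable_comp_mul_left_iff _ ht).2 hi).const_mul _)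
  · rw [e, integral_const_mul, Measure.integral_comp_mul_left
      (fun x : ℝ => (1 - Real.cos (2 * Real.pi * x)) * |x| ^ (-1 - 2 * H)) t, smul_eq_mul,
      ← spectralConst, abs_inv, ← mul_assoc, mul_comm]
    congr 1
    rw [Real.rpow_add ht', Real.rpow_one]
    field_simp

lemma spectralConst_pos {H : ℝ} (hH0 : 0 < H) (hH1 : H < 1) : 0 < spectralConst H := by
  have hn : ∀ x : ℝ, 0 ≤ (1 - Real.cos (2 * Real.pi * x)) * |x| ^ (-1 - 2 * H) := fun x =>
    mul_nonneg (sub_nonneg.2 (Real.cos_le_one _)) (Real.rpow_nonneg (abs_nonneg _) _)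
  rw [spectralConst, integral_pos_iff_support_of_nonneg hn
    (integrable_one_sub_cos_mul_rpow hH0 hH1)]
  refine lt_of_lt_of_le ?_ (measure_mono (s := Set.Ioo (0:ℝ) 1) ?_)
  · simp
  · rintro x ⟨h0, h1⟩
    have hc : Real.cos (2 * Real.pi * x) ≠ 1 := by
      intro h
      obtain ⟨n, hn⟩ := (Real.cos_eq_one_iff _).1 h
      have hx : (n : ℝ) = x := by
        have := Real.pi_pos
        field_simp at hn
        exact hn
      rw [← hx] at h0 h1
      norm_cast at h0 h1
      omega
    have : (0:ℝ) < |x| ^ (-1 - 2 * H) := Real.rpow_pos_of_pos (abs_pos.2 h0.ne') _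
    exact mul_ne_zero (sub_ne_zero.2 (Ne.symm hc)) this.ne'

/-- Spectral representation of the covariance: up to a constant, `fbmForm H t ξ` is the squared
`L²(|x|^{-1-2H} dx)`-norm of `∑ i, ξ i * (e^{2πi (t i) x} - 1)`. -/
lemma integral_norm_sq_sum_wave {ι : Type*} [Fintype ι] {H : ℝ} (hH0 : 0 < H) (hH1 : H < 1)
    (t ξ : ι → ℝ) :
    Integrable (fun x : ℝ => ‖∑ i, (ξ i : ℂ) * (wave (t i) x - 1)‖ ^ 2 * |x| ^ (-1 - 2 * H)) ∧
    ∫ x : ℝ, ‖∑ i, (ξ i : ℂ) * (wave (t i) x - 1)‖ ^ 2 * |x| ^ (-1 - 2 * H) =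
      2 * spectralConst H * fbmForm H t ξ := by
  have e : (fun x : ℝ => ‖∑ i, (ξ i : ℂ) * (wave (t i) x - 1)‖ ^ 2 * |x| ^ (-1 - 2 * H)) =
      fun x => ∑ i, ∑ j, ξ i * ξ j *
        ((1 - Real.cos (2 * Real.pi * (t i * x))) * |x| ^ (-1 - 2 * H) +
         (1 - Real.cos (2 * Real.pi * (t j * x))) * |x| ^ (-1 - 2 * H) -
         (1 - Real.cos (2 * Real.pi * ((t j - t i) * x))) * |x| ^ (-1 - 2 * H)) := by
    ext x
    rw [← Complex.normSq_eq_norm_sq, Complex.normSq_apply, Complex.re_sum, Complex.im_sum,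
      Finset.sum_mul_sum, Finset.sum_mul_sum, ← Finset.sum_add_distrib, Finset.sum_mul]
    refine Finset.sum_congr rfl fun i _ => ?_
    rw [← Finset.sum_add_distrib, Finset.sum_mul]
    refine Finset.sum_congr rfl fun j _ => ?_
    simp only [Complex.re_ofReal_mul, Complex.im_ofReal_mul, Complex.sub_re, Complex.sub_im,
      wave_re, wave_im, Complex.one_re, Complex.one_im]
    have : 2 * Real.pi * ((t j - t i) * x) = 2 * Real.pi * (t j * x) - 2 * Real.pi * (t i * x) := by
      ring
    rw [this, Real.cos_sub]
    ring
  have hi : ∀ i j, Integrable fun x : ℝ => ξ i * ξ j *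
        ((1 - Real.cos (2 * Real.pi * (t i * x))) * |x| ^ (-1 - 2 * H) +
         (1 - Real.cos (2 * Real.pi * (t j * x))) * |x| ^ (-1 - 2 * H) -
         (1 - Real.cos (2 * Real.pi * ((t j - t i) * x))) * |x| ^ (-1 - 2 * H)) := fun i j =>
    ((((integrable_one_sub_cos_mul_rpow_scaled hH0 hH1 (t i)).1).add
      ((integrable_one_sub_cos_mul_rpow_scaled hH0 hH1 (t j)).1)).sub
      ((integrable_one_sub_cos_mul_rpow_scaled hH0 hH1 (t j - t i)).1)).const_mul _
  constructor
  · rw [e]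
    exact integrable_finsetSum _ fun i _ => integrable_finsetSum _ fun j _ => hi i j
  · rw [e, integral_finsetSum _ fun i _ => integrable_finsetSum _ fun j _ => hi i j, fbmForm,
      Finset.mul_sum]
    refine Finset.sum_congr rfl fun i _ => ?_
    rw [integral_finsetSum _ fun j _ => hi i j, Finset.mul_sum]
    refine Finset.sum_congr rfl fun j _ => ?_
    rw [integral_const_mul, integral_sub, integral_add,
      (integrable_one_sub_cos_mul_rpow_scaled hH0 hH1 (t i)).2,
      (integrable_one_sub_cos_mul_rpow_scaled hH0 hH1 (t j)).2,
      (integrable_one_sub_cos_mul_rpow_scaled hH0 hH1 (t j - t i)).2]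
    · ring
    · exact (integrable_one_sub_cos_mul_rpow_scaled hH0 hH1 (t i)).1
    · exact (integrable_one_sub_cos_mul_rpow_scaled hH0 hH1 (t j)).1
    · exact ((integrable_one_sub_cos_mul_rpow_scaled hH0 hH1 (t i)).1).add
        ((integrable_one_sub_cos_mul_rpow_scaled hH0 hH1 (t j)).1)
    · exact (integrable_one_sub_cos_mul_rpow_scaled hH0 hH1 (t j - t i)).1

lemma fbmForm_nonneg {ι : Type*} [Fintype ι] {H : ℝ} (hH0 : 0 < H) (hH1 : H < 1)
    (t ξ : ι → ℝ) : 0 ≤ fbmForm H t ξ := by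
  have h := (integral_norm_sq_sum_wave hH0 hH1 t ξ).2
  have h1 : 0 ≤ 2 * spectralConst H * fbmForm H t ξ := by
    rw [← h]
    exact integral_nonneg fun x => mul_nonneg (sq_nonneg _) (Real.rpow_nonneg (abs_nonneg _) _)
  exact nonneg_of_mul_nonneg_right h1 (by linarith [spectralConst_pos hH0 hH1])

/-- A function which integrates to `1` and is orthogonal to all waves of frequency at least `1`:
the Fourier transform of a smooth bump that is `1` at `0` and supported in `(-1, 1)`. The weighted
integrability is what is needed to pair it with the spectral representation of `fbmForm`. -/
lemma exists_spectral_test_function {H : ℝ} (hH0 : 0 < H) (hH1 : H < 1) :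
    ∃ φ : ℝ → ℂ, Continuous φ ∧ Integrable φ ∧
      Integrable (fun x => ‖φ x‖ ^ 2 * |x| ^ (1 + 2 * H)) ∧
      ∫ x, φ x = 1 ∧ ∀ t : ℝ, 1 ≤ t → ∫ x, wave t x * φ x = 0 := by
  let b : ContDiffBump (0 : ℝ) := ⟨1 / 4, 1 / 2, by norm_num, by norm_num⟩
  have hb : HasCompactSupport fun x => ((b x : ℝ) : ℂ) :=
    b.hasCompactSupport.comp_left (g := fun x : ℝ => (x : ℂ)) (by simp)
  have hb' : ContDiff ℝ ((⊤ : ℕ∞) : WithTop ℕ∞) fun x => ((b x : ℝ) : ℂ) :=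
    Complex.ofRealCLM.contDiff.comp b.contDiff
  let ψ := hb.toSchwartzMap hb'
  have hψ : ∀ x, ψ x = ((b x : ℝ) : ℂ) := fun x => rfl
  let φ := FourierTransform.fourier ψ
  have inv : ∀ t : ℝ, ∫ x, wave t x * φ x = ψ t := by
    intro t
    have h1 := congrFun (Continuous.fourierInv_fourier_eq ψ.continuous ψ.integrable
      (by rw [← SchwartzMap.fourier_coe]; exact φ.integrable)) t
    rw [Real.fourierInv_eq', ← SchwartzMap.fourier_coe] at h1
    rw [← h1]
    refine integral_congr_ae (ae_of_all _ fun x => ?_)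
    simp [wave, φ]
  refine ⟨φ, φ.continuous, φ.integrable, ?_, ?_, fun t ht => ?_⟩
  · obtain ⟨M, hM⟩ : ∃ M, ∀ x, ‖φ x‖ ≤ M := ⟨_, fun x => φ.norm_le_seminorm ℝ x⟩
    have h0 := (φ.integrable_pow_mul volume 0).add (φ.integrable_pow_mul volume 3)
    refine Integrable.mono' (h0.const_mul M) ?_ (ae_of_all _ fun x => ?_)
    · have := φ.continuous.norm.pow 2
      exact this.aestronglyMeasurable.mul (by fun_prop (disch := linarith))
    · rw [Real.norm_of_nonneg (by positivity)]
      simp only [Pi.add_apply, pow_zero, one_mul, Real.norm_eq_abs]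
      have h3 : |x| ^ (1 + 2 * H) ≤ 1 + |x| ^ 3 := by
        rcases le_total |x| 1 with h | h
        · have := Real.rpow_le_one (abs_nonneg x) h (z := 1 + 2 * H) (by linarith)
          have : 0 ≤ |x| ^ 3 := by positivity
          linarith
        · have := Real.rpow_le_rpow_of_exponent_le h (show 1 + 2 * H ≤ (3 : ℕ) by
            push_cast; linarith)
          rw [Real.rpow_natCast] at this
          linarith
      calc ‖φ x‖ ^ 2 * |x| ^ (1 + 2 * H) ≤ (M * ‖φ x‖) * (1 + |x| ^ 3) := by
            refine mul_le_mul ?_ h3 (by positivity) ?_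
            · rw [sq]; exact mul_le_mul_of_nonneg_right (hM x) (norm_nonneg _)
            · exact mul_nonneg ((norm_nonneg _).trans (hM x)) (norm_nonneg _)
        _ = _ := by ring
  · have := inv 0
    simp only [wave, zero_mul, mul_zero, Complex.ofReal_zero, Complex.exp_zero, one_mul] at this
    rw [this, hψ, b.one_of_mem_closedBall (by simp [b])]
    simp
  · rw [inv, hψ, b.zero_of_le_dist]
    · simp
    · simp only [dist_zero_right, Real.norm_eq_abs, b]
      rw [abs_of_nonneg (by linarith)]; linarith

/-! ### Local nondeterminism -/

lemma fbmForm_smul {ι : Type*} [Fintype ι] {H : ℝ} {r : ℝ} (hr : 0 ≤ r) (t ξ : ι → ℝ) :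
    fbmForm H (fun i => r * t i) ξ = r ^ (2 * H) * fbmForm H t ξ := by
  simp only [fbmForm, Finset.mul_sum, ← mul_sub, abs_mul, abs_of_nonneg hr,
    Real.mul_rpow hr (abs_nonneg _)]
  refine Finset.sum_congr rfl fun i _ => Finset.sum_congr rfl fun j _ => ?_
  ring

/-- Testing `∑ i, ξ i * (e^{2πi (t i) x} - 1)` against the spectral test function gives `-∑ i, ξ i`
if all times are at least `1`. -/
lemma exists_sq_sum_le_fbmForm_of_one_le {H : ℝ} (hH0 : 0 < H) (hH1 : H < 1) :
    ∃ K : ℝ, 0 < K ∧ ∀ (m : ℕ) (t ξ : Fin m → ℝ), (∀ i, 1 ≤ t i) →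
      (∑ i, ξ i) ^ 2 ≤ K * fbmForm H t ξ := by
  obtain ⟨φ, hφc, hφi, hφ2, hφ1, hφ0⟩ := exists_spectral_test_function hH0 hH1
  set A := ∫ x, ‖φ x‖ ^ 2 * |x| ^ (1 + 2 * H) with hA
  have hA0 : 0 ≤ A := integral_nonneg fun x =>
    mul_nonneg (sq_nonneg _) (Real.rpow_nonneg (abs_nonneg _) _)
  have hC := spectralConst_pos hH0 hH1
  refine ⟨(A + 1) * (2 * spectralConst H), by positivity, fun m t ξ ht => ?_⟩
  set η := ∑ i, ξ i with hη
  obtain ⟨hSi, hS⟩ := integral_norm_sq_sum_wave hH0 hH1 t ξ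
  have hw : ∀ i, Integrable fun x => wave (t i) x * φ x := fun i =>
    hφi.bdd_mul (c := 1) (continuous_wave _).aestronglyMeasurable
      (ae_of_all _ fun x => (norm_wave _ _).le)
  have hint : ∫ x, (∑ i, (ξ i : ℂ) * (wave (t i) x - 1)) * φ x = -(η : ℂ) := by
    have : (fun x => (∑ i, (ξ i : ℂ) * (wave (t i) x - 1)) * φ x) =
        fun x => ∑ i, (ξ i : ℂ) * (wave (t i) x * φ x - φ x) := by
      ext x
      rw [Finset.sum_mul]
      exact Finset.sum_congr rfl fun i _ => by ring
    have hd : ∀ i, Integrable fun x => (ξ i : ℂ) * (wave (t i) x * φ x - φ x) := fun i =>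
      ((hw i).sub hφi).const_mul _
    rw [this, integral_finsetSum _ fun i _ => hd i]
    simp_rw [integral_const_mul]
    rw [Finset.sum_congr rfl fun i _ => by rw [integral_sub (hw i) hφi, hφ0 _ (ht i), hφ1]]
    rw [hη]
    push_cast
    rw [← Finset.sum_mul]
    ring
  -- Cauchy-Schwarz in the weighted space, in the form `2xy ≤ a x² + a⁻¹ y²`; the choice of `a` that
  -- is made afterwards absorbs the second term into the left-hand side
  have hle : ∀ a : ℝ, 0 < a → 2 * |η| ≤ a * (2 * spectralConst H * fbmForm H t ξ) + a⁻¹ * A := by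
    intro a ha
    have h1 : |η| ≤ ∫ x, ‖(∑ i, (ξ i : ℂ) * (wave (t i) x - 1)) * φ x‖ := by
      have := norm_integral_le_integral_norm (μ := volume)
        (fun x => (∑ i, (ξ i : ℂ) * (wave (t i) x - 1)) * φ x)
      rwa [hint, norm_neg, Complex.norm_real] at this
    rw [← hS, hA, ← integral_const_mul, ← integral_const_mul, ← integral_add
      (hSi.const_mul _) (hφ2.const_mul _)]
    refine (mul_le_mul_of_nonneg_left h1 zero_le_two).trans ?_
    rw [← integral_const_mul]
    refine integral_mono_of_nonneg (ae_of_all _ fun x => by positivity)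
      ((hSi.const_mul _).add (hφ2.const_mul _)) ?_
    have h0 : ∀ᵐ x : ℝ, x ≠ 0 := by simp [ae_iff]
    filter_upwards [h0] with x hx
    have hx' : 0 < |x| := abs_pos.2 hx
    have hp : 0 < |x| ^ (1 + 2 * H) := Real.rpow_pos_of_pos hx' _
    have he : |x| ^ (-1 - 2 * H) = (|x| ^ (1 + 2 * H))⁻¹ := by
      rw [← Real.rpow_neg hx'.le]; congr 1; ring
    simp only [norm_mul]
    rw [he]
    set S := ‖∑ i, (ξ i : ℂ) * (wave (t i) x - 1)‖
    set w := |x| ^ (1 + 2 * H)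
    have : a * (S ^ 2 * w⁻¹) + a⁻¹ * (‖φ x‖ ^ 2 * w) - 2 * (S * ‖φ x‖) =
        (a * w⁻¹) * (S - a⁻¹ * w * ‖φ x‖) ^ 2 := by
      field_simp
      ring
    have h2 : 0 ≤ (a * w⁻¹) * (S - a⁻¹ * w * ‖φ x‖) ^ 2 := by positivity
    linarith
  rcases eq_or_ne η 0 with h | h
  · rw [h, zero_pow two_ne_zero]
    exact mul_nonneg (by positivity) (fbmForm_nonneg hH0 hH1 t ξ)
  have hη' : 0 < |η| := abs_pos.2 h
  have h2 := hle ((A + 1) / |η|) (by positivity)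
  have h3 : ((A + 1) / |η|)⁻¹ * A ≤ |η| := by
    rw [inv_div, div_mul_eq_mul_div, div_le_iff₀ (by positivity)]
    nlinarith
  have h4 : |η| ≤ (A + 1) / |η| * (2 * spectralConst H * fbmForm H t ξ) := by linarith
  rw [div_mul_eq_mul_div, le_div_iff₀ hη'] at h4
  rw [← sq_abs]
  linarith

/-- Strong local nondeterminism at the origin: if all times are at least `r`, the variance of
`∑ i, ξ i * X (t i)` is at least that of `(∑ i, ξ i) * X r`, up to a constant which depends neither
on the number of times nor on the times. -/
lemma exists_sq_sum_mul_rpow_le_fbmForm {H : ℝ} (hH0 : 0 < H) (hH1 : H < 1) :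
    ∃ K : ℝ, 0 < K ∧ ∀ (m : ℕ) (t ξ : Fin m → ℝ) (r : ℝ), 0 ≤ r → (∀ i, r ≤ t i) →
      (∑ i, ξ i) ^ 2 * r ^ (2 * H) ≤ K * fbmForm H t ξ := by
  obtain ⟨K, hK, h⟩ := exists_sq_sum_le_fbmForm_of_one_le hH0 hH1
  refine ⟨K, hK, fun m t ξ r hr ht => ?_⟩
  rcases hr.eq_or_lt with rfl | hr
  · rw [Real.zero_rpow (by positivity), mul_zero]
    exact mul_nonneg hK.le (fbmForm_nonneg hH0 hH1 t ξ)
  have h1 := h m (fun i => r⁻¹ * t i) ξ fun i => by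
    rw [inv_mul_eq_div, one_le_div hr]; exact ht i
  have h2 : t = fun i => r * (r⁻¹ * t i) := by ext i; field_simp
  conv_rhs => rw [h2]
  rw [fbmForm_smul hr.le]
  have : 0 ≤ r ^ (2 * H) := Real.rpow_nonneg hr.le _
  nlinarith

/-- Stationarity of increments. The left-hand side is the variance of
`∑ i, ξ (i + 1) * (X (t (i + 1)) - X (t 0))`, which is the difference of `∑ i, ξ i * X (t i)` and
`(∑ i, ξ i) * X (t 0)`. -/
lemma fbmForm_tail_le {m : ℕ} {H : ℝ} (hH0 : 0 < H) (hH1 : H < 1) (t ξ : Fin (m + 1) → ℝ)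
    (h0 : 0 ≤ t 0) :
    fbmForm H (fun i => Fin.tail t i - t 0) (Fin.tail ξ) ≤
      2 * fbmForm H t ξ + 2 * ((∑ i, ξ i) ^ 2 * t 0 ^ (2 * H)) := by
  have hC := spectralConst_pos hH0 hH1
  obtain ⟨i1, e1⟩ := integral_norm_sq_sum_wave hH0 hH1 (fun i => Fin.tail t i - t 0) (Fin.tail ξ)
  obtain ⟨i2, e2⟩ := integral_norm_sq_sum_wave hH0 hH1 t ξ
  obtain ⟨i3, e3⟩ := integral_norm_sq_sum_wave hH0 hH1 (fun _ : Unit => t 0) fun _ => ∑ i, ξ i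
  have e4 : fbmForm H (fun _ : Unit => t 0) (fun _ => ∑ i, ξ i) =
      (∑ i, ξ i) ^ 2 * t 0 ^ (2 * H) := by
    have : (2 * H) ≠ 0 := by positivity
    simp only [fbmForm, Finset.univ_unique, Finset.sum_const, Finset.card_singleton, one_smul,
      sub_self, abs_zero, Real.zero_rpow this, abs_of_nonneg h0]
    ring
  rw [e4] at e3
  have key := integral_mono i1 ((i2.const_mul 2).add (i3.const_mul 2)) fun x => by
    simp only [Pi.add_apply, Finset.univ_unique, Finset.sum_const, Finset.card_singleton, one_smul]
    rw [← mul_assoc, ← mul_assoc, ← add_mul]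
    refine mul_le_mul_of_nonneg_right ?_ (Real.rpow_nonneg (abs_nonneg _) _)
    have : ‖∑ i, (Fin.tail ξ i : ℂ) * (wave (Fin.tail t i - t 0) x - 1)‖ =
        ‖(∑ i, (ξ i : ℂ) * (wave (t i) x - 1)) - ((∑ i, ξ i : ℝ) : ℂ) * (wave (t 0) x - 1)‖ := by
      rw [← one_mul ‖∑ i, (Fin.tail ξ i : ℂ) * _‖, ← norm_wave (t 0) x, ← norm_mul]
      congr 1
      rw [Fin.sum_univ_succ, Fin.sum_univ_succ, Finset.mul_sum]
      push_cast
      rw [add_mul, add_sub_add_left_eq_sub, Finset.sum_mul, ← Finset.sum_sub_distrib]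
      refine Finset.sum_congr rfl fun i _ => ?_
      have : wave (t i.succ) x = wave (t 0) x * wave (t i.succ - t 0) x := by
        rw [← wave_add]; congr 1; ring
      simp only [Fin.tail]
      rw [this]
      ring
    rw [this]
    have h5 := norm_sub_le (∑ i, (ξ i : ℂ) * (wave (t i) x - 1))
      (((∑ i, ξ i : ℝ) : ℂ) * (wave (t 0) x - 1))
    set a := ‖∑ i, (ξ i : ℂ) * (wave (t i) x - 1)‖
    set b := ‖((∑ i, ξ i : ℝ) : ℂ) * (wave (t 0) x - 1)‖
    calc _ ≤ (a + b) ^ 2 := pow_le_pow_left₀ (norm_nonneg _) h5 2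
      _ ≤ 2 * a ^ 2 + 2 * b ^ 2 := by nlinarith [sq_nonneg (a - b)]
  simp only [Pi.add_apply] at key
  rw [integral_add (i2.const_mul 2) (i3.const_mul 2), integral_const_mul, integral_const_mul,
    e1, e2, e3] at key
  have : 2 * spectralConst H * fbmForm H (fun i => Fin.tail t i - t 0) (Fin.tail ξ) ≤
      2 * spectralConst H * (2 * fbmForm H t ξ + 2 * ((∑ i, ξ i) ^ 2 * t 0 ^ (2 * H))) := by
    linarith
  exact le_of_mul_le_mul_left this (by positivity)

/-- The form `∑ j, η j ^ 2 * (s j - s (j - 1)) ^ (2 * H)`, where `η j` is the sum of the `ξ i` with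
`i ≥ j` and where `s (-1)` is read as `u`. It is the variance that `∑ j, ξ j * (X (s j) - X u)`
would have if the successive increments of `X` were independent. -/
noncomputable def chainForm (H : ℝ) : (m : ℕ) → ℝ → (Fin m → ℝ) → (Fin m → ℝ) → ℝ
  | 0, _, _, _ => 0
  | m + 1, u, s, ξ =>
    (∑ i, ξ i) ^ 2 * (s 0 - u) ^ (2 * H) + chainForm H m (s 0) (Fin.tail s) (Fin.tail ξ)

lemma exists_chainForm_le_fbmForm_shift {H : ℝ} (hH0 : 0 < H) (hH1 : H < 1) (m : ℕ) :
    ∃ K : ℝ, 0 < K ∧ ∀ (u : ℝ) (s ξ : Fin m → ℝ), (∀ i, u ≤ s i) → Monotone s →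
      chainForm H m u s ξ ≤ K * fbmForm H (fun i => s i - u) ξ := by
  obtain ⟨K, hK, h1⟩ := exists_sq_sum_mul_rpow_le_fbmForm hH0 hH1
  induction m with
  | zero => exact ⟨1, one_pos, fun u s ξ _ _ => by simp [chainForm, fbmForm]⟩
  | succ m ih =>
    obtain ⟨K', hK', h2⟩ := ih
    refine ⟨K + K' * (2 + 2 * K), by positivity, fun u s ξ hu hs => ?_⟩
    have h3 := h1 (m + 1) (fun i => s i - u) ξ (s 0 - u) (sub_nonneg.2 (hu 0)) fun i =>
      sub_le_sub_right (hs (Fin.zero_le i)) _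
    have h4 := h2 (s 0) (Fin.tail s) (fun i => ξ i.succ) (fun i => hs (Fin.zero_le _))
      (hs.comp (Fin.strictMono_succ).monotone)
    have h5 := fbmForm_tail_le hH0 hH1 (fun i => s i - u) ξ (sub_nonneg.2 (hu 0))
    simp only [Fin.tail, sub_sub_sub_cancel_right] at h5
    change fbmForm H (fun i : Fin m => s i.succ - s 0) (fun i : Fin m => ξ i.succ) ≤ _ at h5
    have h7 : chainForm H (m + 1) u s ξ = (∑ i, ξ i) ^ 2 * (s 0 - u) ^ (2 * H) +
        chainForm H m (s 0) (Fin.tail s) fun i => ξ i.succ := rfl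
    simp only [Fin.tail] at h4 h7
    rw [h7]
    have h6 : K' * fbmForm H (fun i => s (Fin.succ i) - s 0) (fun i => ξ i.succ) ≤
        K' * (2 * fbmForm H (fun i => s i - u) ξ + 2 * (K * fbmForm H (fun i => s i - u) ξ)) :=
      mul_le_mul_of_nonneg_left (h5.trans (by linarith)) hK'.le
    linarith

/-- Local nondeterminism in chain form. The starting time `u` of the chain may be any number in
`[0, s 0]`, since raising it from `0` only decreases the first term. -/
lemma exists_mul_chainForm_le_fbmForm {H : ℝ} (hH0 : 0 < H) (hH1 : H < 1) (m : ℕ) :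
    ∃ c : ℝ, 0 < c ∧ ∀ (u : ℝ) (s ξ : Fin m → ℝ), 0 ≤ u → (∀ i, u ≤ s i) → Monotone s →
      c * chainForm H m u s ξ ≤ fbmForm H s ξ := by
  obtain ⟨K, hK, h⟩ := exists_chainForm_le_fbmForm_shift hH0 hH1 m
  refine ⟨K⁻¹, by positivity, fun u s ξ hu hs hm => ?_⟩
  have h1 := h 0 s ξ (fun i => hu.trans (hs i)) hm
  simp only [sub_zero] at h1
  rw [inv_mul_le_iff₀ hK]
  refine le_trans ?_ h1
  cases m with
  | zero => simp [chainForm]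
  | succ m =>
    simp only [chainForm]
    gcongr ?_ * ?_ + _
    exact Real.rpow_le_rpow (sub_nonneg.2 (hs 0)) (by linarith) (by positivity)

/-! ### Integration over ordered times -/

lemma exists_lintegral_abs_pow_mul_exp_le (H : ℝ) {c : ℝ} (hc : 0 < c) (b : ℕ) :
    ∃ G : ℝ≥0, ∀ d : ℝ, 0 < d →
      ∫⁻ η : ℝ, ENNReal.ofReal (|η| ^ b * Real.exp (-(c * (η ^ 2 * d ^ (2 * H))))) ≤
        G * ENNReal.ofReal (d ^ (-(H * (b + 1)))) := by
  have hg : Integrable fun η : ℝ => |η| ^ b * Real.exp (-c * η ^ 2) := by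
    have := (integrable_rpow_mul_exp_neg_mul_sq hc (s := b)
      (by linarith [Nat.cast_nonneg (α := ℝ) b])).norm
    simpa [Real.rpow_natCast, abs_pow] using this
  set I := ∫ η : ℝ, |η| ^ b * Real.exp (-c * η ^ 2) with hI
  have hI0 : 0 ≤ I := integral_nonneg fun x => by positivity
  refine ⟨I.toNNReal, fun d hd => ?_⟩
  set k := d ^ H with hk
  have hk0 : 0 < k := Real.rpow_pos_of_pos hd _
  have hk2 : d ^ (2 * H) = k ^ 2 := by
    rw [hk, mul_comm, Real.rpow_mul hd.le]; norm_cast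
  have e : (fun η : ℝ => |η| ^ b * Real.exp (-(c * (η ^ 2 * d ^ (2 * H))))) =
      fun η => (k ^ b)⁻¹ * (|k * η| ^ b * Real.exp (-c * (k * η) ^ 2)) := by
    ext η
    rw [hk2, abs_mul, abs_of_pos hk0]
    have : -c * (k * η) ^ 2 = -(c * (η ^ 2 * k ^ 2)) := by ring
    rw [this, mul_pow]
    field_simp
  have hi := ((integrable_comp_mul_left_iff _ hk0.ne').2 hg).const_mul (k ^ b)⁻¹
  rw [← ofReal_integral_eq_lintegral_ofReal (by rw [e]; exact hi)
    (ae_of_all _ fun x => by positivity), e, integral_const_mul,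
    Measure.integral_comp_mul_left (fun η : ℝ => |η| ^ b * Real.exp (-c * η ^ 2)) k, ← hI,
    smul_eq_mul, abs_of_pos (inv_pos.2 hk0), ENNReal.ofNNReal_toNNReal, ← ENNReal.ofReal_mul hI0]
  refine (congrArg ENNReal.ofReal ?_).le
  have : d ^ (-(H * (b + 1))) = (k ^ b)⁻¹ * k⁻¹ := by
    rw [Real.rpow_neg hd.le, Real.rpow_mul hd.le, ← hk, ← mul_inv]
    norm_cast
  rw [this]
  ring

/-- The integral over the frequency `ξ` attached to the smallest time; `τ` is the sum of the other
frequencies and `d` the time step. Substituting `η = ξ + τ` turns the polynomial weight into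
`|η - τ|^ℓ ≤ 2^ℓ (|η|^ℓ + |τ|^ℓ)`. -/
lemma exists_lintegral_shifted_le (H : ℝ) {c : ℝ} (hc : 0 < c) (ℓ a : ℕ) :
    ∃ G : ℝ≥0, ∀ d τ : ℝ, 0 < d →
      ∫⁻ ξ : ℝ, ENNReal.ofReal (|ξ + τ| ^ a) *
        ENNReal.ofReal (|ξ| ^ ℓ * Real.exp (-(c * ((ξ + τ) ^ 2 * d ^ (2 * H))))) ≤
      G * (ENNReal.ofReal (d ^ (-(H * (a + ℓ + 1)))) +
        ENNReal.ofReal (d ^ (-(H * (a + 1)))) * ENNReal.ofReal (|τ| ^ ℓ)) := by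
  obtain ⟨G₁, h₁⟩ := exists_lintegral_abs_pow_mul_exp_le H hc (a + ℓ)
  obtain ⟨G₂, h₂⟩ := exists_lintegral_abs_pow_mul_exp_le H hc a
  refine ⟨2 ^ ℓ * (G₁ + G₂), fun d τ hd => ?_⟩
  have e := lintegral_add_right_eq_self (μ := (volume : Measure ℝ)) (fun η : ℝ =>
    ENNReal.ofReal (|η| ^ a) *
        ENNReal.ofReal (|η - τ| ^ ℓ * Real.exp (-(c * (η ^ 2 * d ^ (2 * H)))))) τ
  simp only [add_sub_cancel_right] at e
  rw [e]
  have hle : ∀ η : ℝ, ENNReal.ofReal (|η| ^ a) *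
        ENNReal.ofReal (|η - τ| ^ ℓ * Real.exp (-(c * (η ^ 2 * d ^ (2 * H))))) ≤
      2 ^ ℓ * (ENNReal.ofReal (|η| ^ (a + ℓ) * Real.exp (-(c * (η ^ 2 * d ^ (2 * H))))) +
        ENNReal.ofReal (|τ| ^ ℓ) *
          ENNReal.ofReal (|η| ^ a * Real.exp (-(c * (η ^ 2 * d ^ (2 * H)))))) := by
    intro η
    rw [← ENNReal.ofReal_mul (by positivity), ← ENNReal.ofReal_mul (by positivity),
      ← ENNReal.ofReal_add (by positivity) (by positivity),
      show (2 : ℝ≥0∞) ^ ℓ = ENNReal.ofReal (2 ^ ℓ) by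
        rw [ENNReal.ofReal_pow zero_le_two, ENNReal.ofReal_ofNat],
      ← ENNReal.ofReal_mul (by positivity)]
    refine ENNReal.ofReal_le_ofReal ?_
    have h3 : |η - τ| ^ ℓ ≤ 2 ^ ℓ * (|η| ^ ℓ + |τ| ^ ℓ) := by
      calc |η - τ| ^ ℓ ≤ (|η| + |τ|) ^ ℓ := pow_le_pow_left₀ (abs_nonneg _) (abs_sub _ _) _
        _ ≤ 2 ^ (ℓ - 1) * (|η| ^ ℓ + |τ| ^ ℓ) := add_pow_le (abs_nonneg _) (abs_nonneg _) _
        _ ≤ _ := by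
          refine mul_le_mul_of_nonneg_right ?_ (by positivity)
          exact pow_le_pow_right₀ one_le_two (Nat.sub_le _ _)
    set E := Real.exp (-(c * (η ^ 2 * d ^ (2 * H))))
    calc |η| ^ a * (|η - τ| ^ ℓ * E) ≤ |η| ^ a * (2 ^ ℓ * (|η| ^ ℓ + |τ| ^ ℓ) * E) := by gcongr
      _ = _ := by ring
  refine (lintegral_mono hle).trans ?_
  rw [lintegral_const_mul _ (by fun_prop), lintegral_add_left (by fun_prop),
    lintegral_const_mul _ (by fun_prop)]
  have h₁' := h₁ d hd
  have h₂' := h₂ d hd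
  push_cast at h₁' ⊢
  rw [mul_assoc]
  refine mul_le_mul_right ?_ _
  calc _ ≤ (G₁ : ℝ≥0∞) * ENNReal.ofReal (d ^ (-(H * (a + ℓ + 1)))) +
        ENNReal.ofReal (|τ| ^ ℓ) * (G₂ * ENNReal.ofReal (d ^ (-(H * (a + 1))))) := by gcongr
    _ ≤ (G₁ : ℝ≥0∞) * ENNReal.ofReal (d ^ (-(H * (a + ℓ + 1)))) +
        ENNReal.ofReal (|τ| ^ ℓ) * (G₂ * ENNReal.ofReal (d ^ (-(H * (a + 1))))) +
        (G₂ * ENNReal.ofReal (d ^ (-(H * (a + ℓ + 1)))) +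
        ENNReal.ofReal (|τ| ^ ℓ) * (G₁ * ENNReal.ofReal (d ^ (-(H * (a + 1)))))) := le_self_add
    _ = _ := by ring

lemma lintegral_Icc_rpow_sub {θ : ℝ} (hθ : θ < 1) {u v : ℝ} (huv : u ≤ v) :
    ∫⁻ s in Set.Icc u v, ENNReal.ofReal ((s - u) ^ (-θ)) =
      ENNReal.ofReal ((1 - θ)⁻¹ * (v - u) ^ (1 - θ)) := by
  have h1 : IntervalIntegrable (fun s : ℝ => (s - u) ^ (-θ)) volume u v := by
    have := (intervalIntegral.intervalIntegrable_rpow' (a := 0) (b := v - u)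
      (r := -θ) (by linarith)).comp_sub_right u
    simpa using this
  rw [← restrict_Ioc_eq_restrict_Icc, ← ofReal_integral_eq_lintegral_ofReal h1.1,
    ← intervalIntegral.integral_of_le huv,
    intervalIntegral.integral_comp_sub_right (fun s : ℝ => s ^ (-θ)), sub_self,
    integral_rpow (Or.inl (by linarith)), Real.zero_rpow (by linarith)]
  · congr 1
    rw [show -θ + 1 = 1 - θ by ring]
    field_simp
    simp
  · filter_upwards [ae_restrict_mem measurableSet_Ioc] with s hs
    exact Real.rpow_nonneg (sub_nonneg.2 hs.1.le) _

/-- The density that is left on the simplex `u ≤ s 0 ≤ s 1 ≤ ⋯ ≤ v` of ordered times after local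
nondeterminism has been applied: the product of `|ξ j| ^ ℓ * exp (-c * η j ^ 2 * d j ^ (2 * H))`,
with `d j` the time steps and `η j` the sum of the `ξ i` with `i ≥ j`. A point `z` lists the pairs
`(s j, ξ j)`; the definition by recursion peels off the smallest time. -/
noncomputable def sortedKernel (H c : ℝ) (ℓ : ℕ) (v : ℝ) : (m : ℕ) → ℝ → (Fin m → ℝ × ℝ) → ℝ≥0∞
  | 0, _, _ => 1
  | m + 1, u, z =>
    (if u ≤ (z 0).1 ∧ (z 0).1 ≤ v then
      ENNReal.ofReal (|(z 0).2| ^ ℓ *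
        Real.exp (-(c * ((∑ i, (z i).2) ^ 2 * ((z 0).1 - u) ^ (2 * H)))))
    else 0) * sortedKernel H c ℓ v m (z 0).1 (Fin.tail z)

lemma measurable_sortedKernel {H : ℝ} (c : ℝ) (ℓ : ℕ) (v : ℝ) (m : ℕ) :
    Measurable fun p : ℝ × (Fin m → ℝ × ℝ) => sortedKernel H c ℓ v m p.1 p.2 := by
  induction m with
  | zero => simp only [sortedKernel]; fun_prop
  | succ m ih =>
    simp only [sortedKernel]
    have hs : MeasurableSet {p : ℝ × (Fin (m + 1) → ℝ × ℝ) | p.1 ≤ (p.2 0).1 ∧ (p.2 0).1 ≤ v} :=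
      (measurableSet_le (f := fun p : ℝ × (Fin (m + 1) → ℝ × ℝ) => p.1) (by fun_prop)
        (by fun_prop)).inter (measurableSet_le
          (f := fun p : ℝ × (Fin (m + 1) → ℝ × ℝ) => (p.2 0).1) (by fun_prop) (by fun_prop))
    refine Measurable.mul (Measurable.ite hs (by fun_prop) measurable_const) ?_
    · refine ih.comp (Measurable.prodMk (by fun_prop) ?_)
      exact measurable_pi_lambda _ fun i => by fun_prop

/-- The integral of `sortedKernel`, with the additional weight `|∑ i, ξ i| ^ a` that the recursion
over the smallest time produces. Only `a = 0` and `a = ℓ` occur. -/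
noncomputable def sortedIntegral (H c : ℝ) (ℓ m a : ℕ) (u v : ℝ) : ℝ≥0∞ :=
  ∫⁻ z : Fin m → ℝ × ℝ, ENNReal.ofReal (|∑ i, (z i).2| ^ a) * sortedKernel H c ℓ v m u z

/-- Fubini, splitting off the first pair `(s, ξ)`; the integral over its frequency is innermost. -/
lemma lintegral_fin_succ_eq {m : ℕ} {f : (Fin (m + 1) → ℝ × ℝ) → ℝ≥0∞} (hf : Measurable f) :
    ∫⁻ z, f z = ∫⁻ s : ℝ, ∫⁻ z : Fin m → ℝ × ℝ, ∫⁻ ξ : ℝ, f (Fin.cons (s, ξ) z) := by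
  have h := ((volume_preserving_piFinSuccAbove (fun _ : Fin (m + 1) => ℝ × ℝ) 0).symm _)
  have hcons : ∀ p : (ℝ × ℝ) × (Fin m → ℝ × ℝ),
      (MeasurableEquiv.piFinSuccAbove (fun _ : Fin (m + 1) => ℝ × ℝ) 0).symm p =
        Fin.cons p.1 p.2 := fun p => by
    simp [MeasurableEquiv.piFinSuccAbove, Fin.insertNthEquiv]
  have hm : Measurable fun p : (ℝ × ℝ) × (Fin m → ℝ × ℝ) =>
      (Fin.cons p.1 p.2 : Fin (m + 1) → ℝ × ℝ) := by
    rw [← funext hcons]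
    exact (MeasurableEquiv.piFinSuccAbove (fun _ : Fin (m + 1) => ℝ × ℝ) 0).symm.measurable
  rw [← h.lintegral_comp hf]
  simp only [hcons]
  rw [Measure.volume_eq_prod, lintegral_prod (fun p : (ℝ × ℝ) × (Fin m → ℝ × ℝ) =>
    f (Fin.cons p.1 p.2)) (hf.comp hm).aemeasurable, Measure.volume_eq_prod,
    lintegral_prod]
  · refine lintegral_congr fun s => ?_
    refine lintegral_lintegral_swap (Measurable.aemeasurable ?_)
    exact (hf.comp hm).comp (f := fun q : ℝ × (Fin m → ℝ × ℝ) => ((s, q.1), q.2)) (by fun_prop)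
  · exact (Measurable.lintegral_prod_right' (hf.comp hm)).aemeasurable

/-- One step of the recursion: integrating out the frequency of the smallest time `s` leaves an
integrable power of `s - u` and passes on either no weight or the weight `|∑ i, ξ i| ^ ℓ`. -/
lemma exists_sortedIntegral_succ_le (H : ℝ) {c : ℝ} (hc : 0 < c) (ℓ a : ℕ) :
    ∃ G : ℝ≥0, ∀ (m : ℕ) (u v : ℝ), sortedIntegral H c ℓ (m + 1) a u v ≤
      G * ∫⁻ s in Set.Icc u v,
        (ENNReal.ofReal ((s - u) ^ (-(H * (a + ℓ + 1)))) * sortedIntegral H c ℓ m 0 s v +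
        ENNReal.ofReal ((s - u) ^ (-(H * (a + 1)))) * sortedIntegral H c ℓ m ℓ s v) := by
  obtain ⟨G, hG⟩ := exists_lintegral_shifted_le H hc ℓ a
  refine ⟨G, fun m u v => ?_⟩
  have hk : ∀ (m : ℕ) (u : ℝ), Measurable (sortedKernel H c ℓ v m u) := fun m u =>
    (measurable_sortedKernel c ℓ v m).comp (measurable_const.prodMk measurable_id)
  rw [sortedIntegral, lintegral_fin_succ_eq (by have := hk (m + 1) u; fun_prop)]
  have hsplit : ∀ s : ℝ, ∫⁻ z : Fin m → ℝ × ℝ, ∫⁻ ξ : ℝ,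
      ENNReal.ofReal (|∑ i, ((Fin.cons (s, ξ) z : Fin (m + 1) → ℝ × ℝ) i).2| ^ a) *
        sortedKernel H c ℓ v (m + 1) u (Fin.cons (s, ξ) z) =
      (Set.Icc u v).indicator (fun s => ∫⁻ z : Fin m → ℝ × ℝ, (∫⁻ ξ : ℝ,
        ENNReal.ofReal (|ξ + ∑ i, (z i).2| ^ a) * ENNReal.ofReal (|ξ| ^ ℓ *
          Real.exp (-(c * ((ξ + ∑ i, (z i).2) ^ 2 * (s - u) ^ (2 * H)))))) *
        sortedKernel H c ℓ v m s z) s := by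
    intro s
    by_cases hs : s ∈ Set.Icc u v
    · rw [Set.indicator_of_mem hs]
      refine lintegral_congr fun z => ?_
      rw [← lintegral_mul_const _ (by fun_prop)]
      refine lintegral_congr fun ξ => ?_
      simp only [sortedKernel, Fin.cons_zero, Fin.tail_cons, Fin.sum_univ_succ, Fin.cons_succ]
      rw [if_pos (show u ≤ s ∧ s ≤ v from hs), mul_assoc]
    · rw [Set.indicator_of_notMem hs]
      have : ¬ (u ≤ s ∧ s ≤ v) := hs
      simp [sortedKernel, this]
  simp_rw [hsplit]
  rw [lintegral_indicator measurableSet_Icc, ← lintegral_const_mul' _ _ ENNReal.coe_ne_top,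
    ← restrict_Ioc_eq_restrict_Icc]
  refine lintegral_mono_ae ?_
  filter_upwards [ae_restrict_mem measurableSet_Ioc] with s hs
  have hd : 0 < s - u := sub_pos.2 hs.1
  calc _ ≤ ∫⁻ z : Fin m → ℝ × ℝ, (G * (ENNReal.ofReal ((s - u) ^ (-(H * (a + ℓ + 1)))) +
        ENNReal.ofReal ((s - u) ^ (-(H * (a + 1)))) *
          ENNReal.ofReal (|∑ i, (z i).2| ^ ℓ))) * sortedKernel H c ℓ v m s z :=
        lintegral_mono fun z => mul_le_mul_left (hG _ _ hd) _
    _ = ∫⁻ z : Fin m → ℝ × ℝ, G * (ENNReal.ofReal ((s - u) ^ (-(H * (a + ℓ + 1)))) *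
          (ENNReal.ofReal (|∑ i, (z i).2| ^ 0) * sortedKernel H c ℓ v m s z) +
        ENNReal.ofReal ((s - u) ^ (-(H * (a + 1)))) *
          (ENNReal.ofReal (|∑ i, (z i).2| ^ ℓ) * sortedKernel H c ℓ v m s z)) := by
        refine lintegral_congr fun z => ?_
        rw [pow_zero, ENNReal.ofReal_one]
        ring
    _ = _ := by
        have := hk m s
        rw [lintegral_const_mul _ (by fun_prop), lintegral_add_left (by fun_prop),
          lintegral_const_mul _ (by fun_prop), lintegral_const_mul _ (by fun_prop)]
        rfl

/-- The worst power in the recursion is `(s - u) ^ (-H * (2 * ℓ + 1))`, for `a = ℓ`, and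
`H * (2 * ℓ + 1) < 1` makes it integrable. The bound is stated in terms of an interval `[u, v]` that
contains the actual interval `[s, v]`, so that the degenerate case `s = v` is covered. -/
lemma exists_sortedIntegral_le {H c : ℝ} (hH0 : 0 < H) (hc : 0 < c) {ℓ : ℕ}
    (hH : H * (2 * ℓ + 1) < 1) (m : ℕ) :
    ∃ C : ℝ≥0, ∀ a ∈ ({0, ℓ} : Set ℕ), ∀ u s v : ℝ, u ≤ s → s ≤ v → u < v →
      sortedIntegral H c ℓ m a s v ≤
        C * ENNReal.ofReal ((v - u) ^ (m * (1 - H * (ℓ + 1)) - H * a)) := by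
  have hℓ0 : (0 : ℝ) ≤ ℓ := Nat.cast_nonneg _
  have hHℓ : 0 ≤ H * ℓ := by positivity
  induction m with
  | zero =>
    refine ⟨1, fun a ha u s v hus hsv huv => ?_⟩
    simp only [sortedIntegral, sortedKernel, Finset.univ_eq_empty, Finset.sum_empty, abs_zero,
      mul_one, lintegral_const]
    rw [show (volume : Measure (Fin 0 → ℝ × ℝ)) Set.univ = 1 by
      rw [volume_pi, Measure.pi_of_empty]; simp]
    rcases Nat.eq_zero_or_pos a with rfl | h0
    · simp
    · simp [h0.ne']
  | succ m ih =>
    obtain ⟨C, hC⟩ := ih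
    have key : ∀ a : ℕ, a ∈ ({0, ℓ} : Set ℕ) → ∃ C' : ℝ≥0, ∀ u s v : ℝ, u ≤ s → s ≤ v → u < v →
        sortedIntegral H c ℓ (m + 1) a s v ≤
          C' * ENNReal.ofReal ((v - u) ^ ((m + 1 : ℕ) * (1 - H * (ℓ + 1)) - H * a)) := by
      intro a ha
      obtain ⟨G, hG⟩ := exists_sortedIntegral_succ_le H hc ℓ a
      have ha' : H * a ≤ H * ℓ := by
        rcases ha with rfl | ha
        · simpa using hHℓ
        · rw [Set.mem_singleton_iff.1 ha]
      have ha0 : 0 ≤ H * (a : ℝ) := by positivity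
      have hθ₁ : H * (a + ℓ + 1) < 1 := by nlinarith
      have hθ₂ : H * (a + 1) < 1 := by nlinarith
      have hβ : 0 ≤ m * (1 - H * (ℓ + 1)) :=
        mul_nonneg (Nat.cast_nonneg _) (by nlinarith)
      set K₁ := (1 - H * (a + ℓ + 1))⁻¹ with hK₁
      set K₂ := (1 - H * (a + 1))⁻¹ with hK₂
      have hK₁0 : 0 ≤ K₁ := inv_nonneg.2 (by linarith)
      have hK₂0 : 0 ≤ K₂ := inv_nonneg.2 (by linarith)
      refine ⟨G * (C * (K₁ + K₂).toNNReal), fun u s v hus hsv huv => ?_⟩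
      rcases hsv.eq_or_lt with rfl | hsv
      · refine (hG m s s).trans ?_
        simp
      have hvs : 0 < v - s := sub_pos.2 hsv
      refine (hG m s v).trans ?_
      rw [ENNReal.coe_mul, mul_assoc]
      refine mul_le_mul_right ?_ _
      calc _ ≤ ∫⁻ r in Set.Icc s v, (ENNReal.ofReal ((r - s) ^ (-(H * (a + ℓ + 1)))) *
              (C * ENNReal.ofReal ((v - s) ^ (m * (1 - H * (ℓ + 1)) - H * (0 : ℕ)))) +
            ENNReal.ofReal ((r - s) ^ (-(H * (a + 1)))) *
              (C * ENNReal.ofReal ((v - s) ^ (m * (1 - H * (ℓ + 1)) - H * ℓ)))) := by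
            refine setLIntegral_mono' measurableSet_Icc fun r hr => ?_
            have h1 := hC 0 (by simp) s r v hr.1 hr.2 hsv
            have h2 := hC ℓ (by simp) s r v hr.1 hr.2 hsv
            gcongr
        _ = C * ENNReal.ofReal ((K₁ + K₂) *
              (v - s) ^ ((m + 1 : ℕ) * (1 - H * (ℓ + 1)) - H * a)) := by
            rw [lintegral_add_left (by fun_prop), lintegral_mul_const _ (by fun_prop),
              lintegral_mul_const _ (by fun_prop), lintegral_Icc_rpow_sub hθ₁ hsv.le,
              lintegral_Icc_rpow_sub hθ₂ hsv.le, mul_left_comm, mul_left_comm _ (C : ℝ≥0∞),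
              ← mul_add, ← ENNReal.ofReal_mul (by positivity), ← ENNReal.ofReal_mul (by positivity),
              ← ENNReal.ofReal_add (by positivity) (by positivity), ← hK₁, ← hK₂, mul_assoc,
              mul_assoc, ← Real.rpow_add hvs, ← Real.rpow_add hvs, add_mul]
            congr 4
            · congr 1; push_cast; ring
            · congr 1; push_cast; ring
        _ ≤ _ := by
            rw [ENNReal.coe_mul, mul_assoc, ENNReal.ofNNReal_toNNReal,
              ← ENNReal.ofReal_mul (by positivity)]
            gcongr
            push_cast
            nlinarith
    obtain ⟨C₁, h₁⟩ := key 0 (by simp)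
    obtain ⟨C₂, h₂⟩ := key ℓ (by simp)
    refine ⟨C₁ + C₂, fun a ha u s v hus hsv huv => ?_⟩
    rw [ENNReal.coe_add, add_mul]
    rcases ha with rfl | ha
    · exact (h₁ u s v hus hsv huv).trans le_self_add
    · rw [Set.mem_singleton_iff.1 ha]
      exact (h₂ u s v hus hsv huv).trans le_add_self

/-- The integral over `(s, ξ) ∈ ((u, v] × ℝ)^m` of `∏ j, κ (ξ j)` against
`E[exp (i ∑ j, ξ j * X (s j))]`. With `κ = |k|` it bounds the `m`-th moment of
`∫ k(ξ) exp (i ξ X_s) ds dξ` over `(u, v] × ℝ`; see `lintegral_enorm_occupationFourier_pow_le`. -/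
noncomputable def momentIntegral (H : ℝ) (m : ℕ) (u v : ℝ) (κ : ℝ → ℝ≥0∞) : ℝ≥0∞ :=
  ∫⁻ z : Fin m → ℝ × ℝ, (∏ j, (Set.Ioc u v).indicator 1 (z j).1 * κ (z j).2) *
    ENNReal.ofReal (Real.exp (-(fbmForm H (fun j => (z j).1) (fun j => (z j).2) / 2)))

lemma measurable_fbmForm (H : ℝ) (m : ℕ) :
    Measurable fun z : Fin m → ℝ × ℝ => fbmForm H (fun j => (z j).1) (fun j => (z j).2) := by
  unfold fbmForm
  fun_prop

lemma fbmForm_comp_equiv {ι : Type*} [Fintype ι] (H : ℝ) (σ : Equiv.Perm ι) (t ξ : ι → ℝ) :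
    fbmForm H (t ∘ σ) (ξ ∘ σ) = fbmForm H t ξ := by
  unfold fbmForm
  rw [← Equiv.sum_comp σ fun i => ∑ j, ξ i * ξ j *
    (1 / 2 * (|t i| ^ (2 * H) + |t j| ^ (2 * H) - |t j - t i| ^ (2 * H)))]
  refine Finset.sum_congr rfl fun i _ => ?_
  rw [← Equiv.sum_comp σ fun j => ξ (σ i) * ξ j *
    (1 / 2 * (|t (σ i)| ^ (2 * H) + |t j| ^ (2 * H) - |t j - t (σ i)| ^ (2 * H)))]
  rfl

/-- For ordered times in `[u, v]` this is an equality; the inequality is what is used. -/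
lemma prod_mul_exp_chainForm_le_sortedKernel (H c : ℝ) (ℓ : ℕ) (v : ℝ) (m : ℕ) :
    ∀ (u : ℝ) (z : Fin m → ℝ × ℝ), (∀ i, u ≤ (z i).1) → (∀ i, (z i).1 ≤ v) →
      Monotone (fun i => (z i).1) →
      (∏ j, ENNReal.ofReal (|(z j).2| ^ ℓ)) *
        ENNReal.ofReal (Real.exp (-(c * chainForm H m u (fun j => (z j).1) fun j => (z j).2))) ≤
      sortedKernel H c ℓ v m u z := by
  induction m with
  | zero => intro u z _ _ _; simp [chainForm, sortedKernel]
  | succ m ih =>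
    intro u z hu hv hz
    rw [sortedKernel, if_pos ⟨hu 0, hv 0⟩, chainForm, Fin.prod_univ_succ]
    refine le_trans (le_of_eq ?_) (mul_le_mul_right (ih (z 0).1 (Fin.tail z)
      (fun i => hz (Fin.zero_le _)) (fun i => hv _)
      (hz.comp (Fin.strictMono_succ).monotone)) _)
    rw [mul_add, neg_add, Real.exp_add, ENNReal.ofReal_mul (by positivity),
      ENNReal.ofReal_mul (by positivity)]
    simp only [Fin.tail]
    ring_nf
    rfl

/-- The main estimate. The cube of times is covered by the orderings of its points, and on each
of them local nondeterminism bounds the integrand by `sortedKernel`. -/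
lemma exists_momentIntegral_le {H : ℝ} (hH0 : 0 < H) {ℓ : ℕ} (hH : H * (2 * ℓ + 1) < 1) (m : ℕ) :
    ∃ C : ℝ≥0, ∀ u v : ℝ, 0 ≤ u → u < v →
      momentIntegral H m u v (fun ξ => ENNReal.ofReal (|ξ| ^ ℓ)) ≤
        C * ENNReal.ofReal ((v - u) ^ (m * (1 - H * (ℓ + 1)))) := by
  have hℓ0 : (0 : ℝ) ≤ ℓ := Nat.cast_nonneg _
  have hH1 : H < 1 := by nlinarith
  obtain ⟨c, hc, hcf⟩ := exists_mul_chainForm_le_fbmForm hH0 hH1 m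
  obtain ⟨C, hC⟩ := exists_sortedIntegral_le hH0 (half_pos hc) hH m
  refine ⟨(Fintype.card (Equiv.Perm (Fin m)) : ℝ≥0) * C, fun u v hu huv => ?_⟩
  have hperm : ∀ σ : Equiv.Perm (Fin m),
      ∫⁻ z : Fin m → ℝ × ℝ, sortedKernel H (c / 2) ℓ v m u (z ∘ σ) =
        ∫⁻ z : Fin m → ℝ × ℝ, sortedKernel H (c / 2) ℓ v m u z := by
    intro σ
    have h := volume_measurePreserving_piCongrLeft (fun _ : Fin m => ℝ × ℝ) σ.symm
    have h2 := h.lintegral_comp_emb (MeasurableEquiv.measurableEmbedding _)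
      (fun z : Fin m → ℝ × ℝ => sortedKernel H (c / 2) ℓ v m u z)
    rw [← h2]
    refine lintegral_congr fun z => ?_
    congr 1
    ext1 i
    have := Equiv.piCongrLeft_apply_apply (fun _ : Fin m => ℝ × ℝ) σ.symm z (σ i)
    simp only [Equiv.symm_apply_apply] at this
    exact this.symm
  have hpt : ∀ z : Fin m → ℝ × ℝ,
      (∏ j, (Set.Ioc u v).indicator 1 (z j).1 * ENNReal.ofReal (|(z j).2| ^ ℓ)) *
        ENNReal.ofReal (Real.exp (-(fbmForm H (fun j => (z j).1) (fun j => (z j).2) / 2))) ≤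
      ∑ σ : Equiv.Perm (Fin m), sortedKernel H (c / 2) ℓ v m u (z ∘ σ) := by
    intro z
    by_cases hz : ∀ j, (z j).1 ∈ Set.Ioc u v
    · set σ := Tuple.sort fun j => (z j).1
      have hσ : Monotone ((fun j => (z j).1) ∘ σ) := Tuple.monotone_sort _
      refine le_trans ?_ (Finset.single_le_sum (f := fun σ : Equiv.Perm (Fin m) =>
        sortedKernel H (c / 2) ℓ v m u (z ∘ σ)) (fun _ _ => zero_le) (Finset.mem_univ σ))
      refine le_trans ?_ (prod_mul_exp_chainForm_le_sortedKernel H (c / 2) ℓ v m u (z ∘ σ)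
        (fun i => (hz _).1.le) (fun i => (hz _).2) hσ)
      refine mul_le_mul' (le_of_eq ?_) (ENNReal.ofReal_le_ofReal (Real.exp_le_exp.2 ?_))
      · rw [← Equiv.prod_comp σ]
        refine Finset.prod_congr rfl fun j _ => ?_
        rw [Set.indicator_of_mem (hz _)]
        simp
      · have h1 := hcf u ((fun j => (z j).1) ∘ σ) ((fun j => (z j).2) ∘ σ) hu
          (fun i => (hz _).1.le) hσ
        rw [fbmForm_comp_equiv] at h1
        simp only [Function.comp_def] at h1 ⊢
        linarith
    · push Not at hz
      obtain ⟨j, hj⟩ := hz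
      rw [Finset.prod_eq_zero (Finset.mem_univ j) (by rw [Set.indicator_of_notMem hj, zero_mul]),
        zero_mul]
      exact zero_le
  have hk : Measurable (sortedKernel H (c / 2) ℓ v m u) :=
    (measurable_sortedKernel (c / 2) ℓ v m).comp (measurable_const.prodMk measurable_id)
  calc _ ≤ ∫⁻ z : Fin m → ℝ × ℝ,
        ∑ σ : Equiv.Perm (Fin m), sortedKernel H (c / 2) ℓ v m u (z ∘ σ) := lintegral_mono hpt
    _ = ∑ σ : Equiv.Perm (Fin m), ∫⁻ z : Fin m → ℝ × ℝ,
          sortedKernel H (c / 2) ℓ v m u (z ∘ σ) := by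
        refine lintegral_finsetSum _ fun σ _ => hk.comp ?_
        exact measurable_pi_lambda _ fun i => measurable_pi_apply _
    _ = Fintype.card (Equiv.Perm (Fin m)) * sortedIntegral H (c / 2) ℓ m 0 u v := by
        rw [Finset.sum_congr rfl fun σ _ => hperm σ, Finset.sum_const, nsmul_eq_mul]
        simp [sortedIntegral]
    _ ≤ _ := by
        have := hC 0 (by simp) u u v le_rfl huv.le huv
        rw [Nat.cast_zero, mul_zero, sub_zero] at this
        push_cast
        rw [mul_assoc]
        gcongr

/-! ### Moments of Fourier integrals of the occupation measure -/

section CharFun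
variable {Ω : Type*} [MeasurableSpace Ω] {P : Measure Ω} [IsProbabilityMeasure P]
  {H : ℝ} {X : ℝ≥0 → Ω → ℝ}

/-- The joint characteristic function at finitely many times. -/
lemma IsFractionalBrownianMotion.integral_cexp_sum (hX : IsFractionalBrownianMotion H X P)
    {m : ℕ} (t : Fin m → ℝ≥0) (ξ : Fin m → ℝ) :
    ∫ ω, Complex.exp (Complex.I * ∑ j, (ξ j : ℂ) * (X (t j) ω : ℂ)) ∂P =
      Real.exp (-(fbmForm H (fun j => (t j : ℝ)) ξ / 2)) := by
  have hG : HasGaussianLaw (fun ω => ∑ j, ξ j * X (t j) ω) P := by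
    have := ((hX.isGaussianProcess.comp_right t).smul ξ).hasGaussianLaw_fun_sum
      (I := Finset.univ)
    simpa using this
  have h2 : ∀ s, MemLp (X s) 2 P := fun s =>
    (hX.isGaussianProcess.hasGaussianLaw_eval s).memLp_two
  have hi : ∀ s, Integrable (X s) P := fun s =>
    (hX.isGaussianProcess.hasGaussianLaw_eval s).integrable
  have hii : ∀ i j, Integrable (fun ω => ξ i * ξ j * (X (t i) ω * X (t j) ω)) P := fun i j =>
    ((h2 (t i)).integrable_mul (h2 (t j))).const_mul _
  have hmean : ∫ ω, ∑ j, ξ j * X (t j) ω ∂P = 0 := by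
    rw [integral_finsetSum _ fun j _ => (hi _).const_mul _]
    simp [integral_const_mul, hX.mean_eq_zero]
  have hvar : Var[fun ω => ∑ j, ξ j * X (t j) ω; P] = fbmForm H (fun j => (t j : ℝ)) ξ := by
    rw [variance_eq_sub hG.memLp_two, hmean]
    have : ((fun ω => ∑ j, ξ j * X (t j) ω) ^ 2) =
        fun ω => ∑ i, ∑ j, ξ i * ξ j * (X (t i) ω * X (t j) ω) := by
      ext ω
      simp only [Pi.pow_apply, sq, Finset.sum_mul_sum]
      exact Finset.sum_congr rfl fun i _ => Finset.sum_congr rfl fun j _ => by ring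
    rw [this, integral_finsetSum _ fun i _ => integrable_finsetSum _ fun j _ => hii i j, fbmForm,
      zero_pow two_ne_zero, sub_zero]
    refine Finset.sum_congr rfl fun i _ => ?_
    rw [integral_finsetSum _ fun j _ => hii i j]
    refine Finset.sum_congr rfl fun j _ => ?_
    rw [integral_const_mul, hX.covariance_eq, abs_of_nonneg (NNReal.coe_nonneg (t i)),
      abs_of_nonneg (NNReal.coe_nonneg (t j))]
  have h := charFun_gaussianReal (μ := 0) (v := (fbmForm H (fun j => (t j : ℝ)) ξ).toNNReal) 1
  have hmap := hG.map_eq_gaussianReal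
  rw [hmean, hvar] at hmap
  rw [← hmap, charFun_apply_real, integral_map hG.aemeasurable (by fun_prop)] at h
  have hnn : 0 ≤ fbmForm H (fun j => (t j : ℝ)) ξ := by rw [← hvar]; exact variance_nonneg _ _
  convert h using 1
  · refine integral_congr_ae (ae_of_all _ fun ω => ?_)
    simp only
    congr 1
    push_cast
    ring
  · rw [Complex.ofReal_exp]
    congr 1
    have : (((fbmForm H (fun j => (t j : ℝ)) ξ).toNNReal : ℝ≥0) : ℂ) =
      (fbmForm H (fun j => (t j : ℝ)) ξ : ℂ) := by
      exact congrArg Complex.ofReal (Real.coe_toNNReal _ hnn)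
    rw [this]
    push_cast
    ring

/-- `Y` is jointly measurable and agrees with `X` up to a null set of pairs `(s, ω)`; both iterated
forms of this condition are recorded. Negative times are sent to `0`, as in the
definition of fractional Brownian motion. -/
structure IsMeasurableVersion (P : Measure Ω) (X : ℝ≥0 → Ω → ℝ) (Y : ℝ → Ω → ℝ) : Prop where
  measurable : Measurable fun q : ℝ × Ω => Y q.1 q.2
  ae_eq : ∀ᵐ s : ℝ, Y s =ᵐ[P] X s.toNNReal
  ae_ae_eq : ∀ᵐ ω ∂P, ∀ᵐ s : ℝ, X s.toNNReal ω = Y s ω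

lemma IsFractionalBrownianMotion.exists_isMeasurableVersion
    (hX : IsFractionalBrownianMotion H X P) : ∃ Y, IsMeasurableVersion P X Y := by
  have h := hX.aemeasurable_joint
  refine ⟨fun s ω => h.mk _ (s, ω), h.measurable_mk, ?_, ?_⟩
  · filter_upwards [Measure.ae_ae_of_ae_prod h.ae_eq_mk] with s hs
    exact EventuallyEq.symm hs
  · exact Measure.ae_ae_of_ae_prod
      (Measure.measurePreserving_swap.quasiMeasurePreserving.ae h.ae_eq_mk)

lemma IsMeasurableVersion.ae_integral_cexp_sum {Y : ℝ → Ω → ℝ} (hY : IsMeasurableVersion P X Y)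
    (hX : IsFractionalBrownianMotion H X P) (m : ℕ) :
    ∀ᵐ z : Fin m → ℝ × ℝ, (∀ j, 0 ≤ (z j).1) →
      ∫ ω, Complex.exp (Complex.I * ∑ j, ((z j).2 : ℂ) * (Y (z j).1 ω : ℂ)) ∂P =
        Real.exp (-(fbmForm H (fun j => (z j).1) (fun j => (z j).2) / 2)) := by
  have h1 : ∀ᵐ q : ℝ × ℝ, Y q.1 =ᵐ[P] X q.1.toNNReal :=
    Measure.quasiMeasurePreserving_fst.ae hY.ae_eq
  have h2 : ∀ᵐ z : Fin m → ℝ × ℝ, ∀ j, Y (z j).1 =ᵐ[P] X (z j).1.toNNReal :=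
    eventually_all.2 fun j =>
      (Measure.tendsto_eval_ae_ae (μ := fun _ : Fin m => (volume : Measure (ℝ × ℝ)))
        (i := j)).eventually h1
  filter_upwards [h2] with z hz hz0
  have h3 := hX.integral_cexp_sum (fun j => (z j).1.toNNReal) fun j => (z j).2
  simp only [Real.coe_toNNReal _ (hz0 _)] at h3
  rw [← h3]
  refine integral_congr_ae ?_
  filter_upwards [eventually_all.2 hz] with ω hω
  simp only [hω]

end CharFun

section Moments
variable {Ω : Type*} {Y : ℝ → Ω → ℝ}

/-- The integrand `1_{(u, v]}(s) * k ξ * exp (i ξ Y_s)` at `q = (s, ξ)`. -/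
noncomputable def occupationTerm (Y : ℝ → Ω → ℝ) (u v : ℝ) (k : ℝ → ℂ) (q : ℝ × ℝ) (ω : Ω) : ℂ :=
  (Set.Ioc u v).indicator 1 q.1 * k q.2 * Complex.exp (Complex.I * ((q.2 : ℂ) * (Y q.1 ω : ℂ)))

/-- The random variable `∫_{(u, v]} ∫ k ξ * exp (i ξ Y_s) dξ ds`: the Fourier transform of the
occupation measure of `Y` on `(u, v]`, integrated against `k`. The approximations of the derivatives
of the local time are all of this form. -/
noncomputable def occupationFourier (Y : ℝ → Ω → ℝ) (u v : ℝ) (k : ℝ → ℂ) (ω : Ω) : ℂ :=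
  ∫ q : ℝ × ℝ, occupationTerm Y u v k q ω

lemma norm_occupationTerm (u v : ℝ) (k : ℝ → ℂ) (q : ℝ × ℝ) (ω : Ω) :
    ‖occupationTerm Y u v k q ω‖ = (Set.Ioc u v).indicator 1 q.1 * ‖k q.2‖ := by
  have : ‖Complex.exp (Complex.I * ((q.2 : ℂ) * (Y q.1 ω : ℂ)))‖ = 1 := by
    rw [mul_comm, ← Complex.ofReal_mul, Complex.norm_exp_ofReal_mul_I]
  rw [occupationTerm, norm_mul, this, mul_one, norm_mul]
  by_cases h : q.1 ∈ Set.Ioc u v <;> simp [h]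

lemma integrable_indicator_mul_norm (u v : ℝ) {k : ℝ → ℂ} (hki : Integrable k) :
    Integrable fun q : ℝ × ℝ => (Set.Ioc u v).indicator (1 : ℝ → ℝ) q.1 * ‖k q.2‖ := by
  have h : Integrable ((Set.Ioc u v).indicator (1 : ℝ → ℝ)) := by
    rw [integrable_indicator_iff measurableSet_Ioc]
    exact integrableOn_const (by simp)
  exact h.mul_prod hki.norm

lemma norm_occupationFourier_le (u v : ℝ) (k : ℝ → ℂ) (ω : Ω) :
    ‖occupationFourier Y u v k ω‖ ≤
      ∫ q : ℝ × ℝ, (Set.Ioc u v).indicator (1 : ℝ → ℝ) q.1 * ‖k q.2‖ := by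
  refine (norm_integral_le_integral_norm _).trans (le_of_eq ?_)
  simp only [norm_occupationTerm]

/-- A multiplier with Hermitian symmetry gives a real random variable; `k` need not be integrable,
because integrals commute with the conjugation in any case. -/
lemma conj_occupationFourier (u v : ℝ) {k : ℝ → ℂ} (hk : ∀ ξ, k (-ξ) = starRingEnd ℂ (k ξ))
    (ω : Ω) : starRingEnd ℂ (occupationFourier Y u v k ω) = occupationFourier Y u v k ω := by
  rw [occupationFourier, ← integral_conj]
  have hmp : MeasurePreserving (MeasurableEquiv.prodCongr (MeasurableEquiv.refl ℝ)
      (MeasurableEquiv.neg ℝ)) :=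
    (MeasurePreserving.id (volume : Measure ℝ)).prod (Measure.measurePreserving_neg volume)
  rw [← hmp.integral_comp']
  refine integral_congr_ae (ae_of_all _ fun q => ?_)
  simp only [occupationTerm, map_mul, ← Complex.exp_conj, Complex.conj_I, Complex.conj_ofReal]
  have : MeasurableEquiv.prodCongr (MeasurableEquiv.refl ℝ) (MeasurableEquiv.neg ℝ) q =
    (q.1, -q.2) := rfl
  rw [this, hk]
  congr 1
  · rw [Complex.conj_conj]
    congr 1
    by_cases h : q.1 ∈ Set.Ioc u v <;> simp [h]
  · congr 1
    push_cast
    ring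

lemma occupationFourier_const_mul (u v : ℝ) (c : ℂ) (k : ℝ → ℂ) (ω : Ω) :
    occupationFourier Y u v (fun ξ => c * k ξ) ω = c * occupationFourier Y u v k ω := by
  rw [occupationFourier, occupationFourier, ← integral_const_mul]
  exact integral_congr_ae (ae_of_all _ fun q => by simp only [occupationTerm]; ring)

lemma prod_occupationTerm (u v : ℝ) (k : ℝ → ℂ) {m : ℕ} (z : Fin m → ℝ × ℝ) (ω : Ω) :
    ∏ j, occupationTerm Y u v k (z j) ω =
      (∏ j, ((Set.Ioc u v).indicator 1 (z j).1 * k (z j).2)) *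
        Complex.exp (Complex.I * ∑ j, ((z j).2 : ℂ) * (Y (z j).1 ω : ℂ)) := by
  simp only [occupationTerm]
  rw [Finset.prod_mul_distrib, ← Complex.exp_sum, Finset.mul_sum]

variable [MeasurableSpace Ω] {P : Measure Ω} [IsProbabilityMeasure P]
  {H : ℝ} {X : ℝ≥0 → Ω → ℝ}

lemma measurable_occupationTerm (hY : Measurable fun q : ℝ × Ω => Y q.1 q.2) (u v : ℝ) {k : ℝ → ℂ}
    (hk : Measurable k) : Measurable fun p : Ω × (ℝ × ℝ) => occupationTerm Y u v k p.2 p.1 := by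
  have h1 : Measurable fun p : Ω × (ℝ × ℝ) => Y p.2.1 p.1 :=
    hY.comp (f := fun p : Ω × (ℝ × ℝ) => (p.2.1, p.1)) (by fun_prop)
  have h2 : Measurable ((Set.Ioc u v).indicator (1 : ℝ → ℂ)) :=
    measurable_one.indicator measurableSet_Ioc
  unfold occupationTerm
  fun_prop

lemma integrable_occupationTerm (hY : Measurable fun q : ℝ × Ω => Y q.1 q.2) (u v : ℝ) {k : ℝ → ℂ}
    (hk : Measurable k) (hki : Integrable k) (ω : Ω) :
    Integrable fun q => occupationTerm Y u v k q ω :=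
  Integrable.mono' (integrable_indicator_mul_norm u v hki)
    ((measurable_occupationTerm hY u v hk).comp measurable_prodMk_left).aestronglyMeasurable
    (ae_of_all _ fun q => (norm_occupationTerm u v k q ω).le)

lemma stronglyMeasurable_occupationFourier (hY : Measurable fun q : ℝ × Ω => Y q.1 q.2) (u v : ℝ)
    {k : ℝ → ℂ} (hk : Measurable k) : StronglyMeasurable (occupationFourier Y u v k) :=
  StronglyMeasurable.integral_prod_right
    (measurable_occupationTerm hY u v hk).stronglyMeasurable

lemma memLp_occupationFourier (hY : Measurable fun q : ℝ × Ω => Y q.1 q.2) (u v : ℝ) {k : ℝ → ℂ}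
    (hk : Measurable k) (p : ℝ≥0∞) : MemLp (occupationFourier Y u v k) p P :=
  MemLp.of_bound (stronglyMeasurable_occupationFourier hY u v hk).aestronglyMeasurable _
    (ae_of_all _ fun ω => norm_occupationFourier_le u v k ω)

/-- Since the variable is real, its even power is a product of integrals without conjugates. By
Fubini the moment is then the integral of `∏ j, k (ξ j)` against the joint characteristic function
of fractional Brownian motion. -/
lemma lintegral_enorm_occupationFourier_pow_le (hX : IsFractionalBrownianMotion H X P)
    (hY : IsMeasurableVersion P X Y) {u v : ℝ} (hu : 0 ≤ u) {k : ℝ → ℂ}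
    (hk : Measurable k) (hki : Integrable k) (hkc : ∀ ξ, k (-ξ) = starRingEnd ℂ (k ξ)) (n : ℕ) :
    ∫⁻ ω, ‖occupationFourier Y u v k ω‖ₑ ^ (2 * n) ∂P ≤
      momentIntegral H (2 * n) u v fun ξ => ‖k ξ‖ₑ := by
  have hpow : ∀ ω, occupationFourier Y u v k ω ^ (2 * n) =
      ∫ z : Fin (2 * n) → ℝ × ℝ, ∏ j, occupationTerm Y u v k (z j) ω := by
    intro ω
    rw [integral_fintype_prod_volume_eq_pow (ι := Fin (2 * n))
      (fun q => occupationTerm Y u v k q ω), Fintype.card_fin]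
    rfl
  have hreal : ∀ ω, occupationFourier Y u v k ω ^ (2 * n) =
      ((‖occupationFourier Y u v k ω‖ ^ (2 * n) : ℝ) : ℂ) := by
    intro ω
    obtain ⟨r, hr⟩ := Complex.conj_eq_iff_real.1 (conj_occupationFourier (Y := Y) u v hkc ω)
    rw [hr, Complex.norm_real, Real.norm_eq_abs, pow_mul, pow_mul, sq_abs]
    push_cast
    rfl
  have hmeas : Measurable fun p : Ω × (Fin (2 * n) → ℝ × ℝ) =>
      ∏ j, occupationTerm Y u v k (p.2 j) p.1 := by
    refine Finset.measurable_fun_prod _ fun j _ => ?_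
    exact (measurable_occupationTerm hY.measurable u v hk).comp
      (f := fun p : Ω × (Fin (2 * n) → ℝ × ℝ) => (p.1, p.2 j)) (by fun_prop)
  have hint : Integrable (Function.uncurry fun (ω : Ω) (z : Fin (2 * n) → ℝ × ℝ) =>
      ∏ j, occupationTerm Y u v k (z j) ω) (P.prod volume) := by
    have h1 : Integrable fun z : Fin (2 * n) → ℝ × ℝ =>
        ∏ j, ((Set.Ioc u v).indicator (1 : ℝ → ℝ) (z j).1 * ‖k (z j).2‖) :=
      Integrable.fintype_prod fun _ => integrable_indicator_mul_norm u v hki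
    refine Integrable.mono' (h1.comp_snd P) hmeas.aestronglyMeasurable
      (ae_of_all _ fun p => ?_)
    simp only [Function.uncurry, norm_prod, norm_occupationTerm]
    exact le_rfl
  have hnn : 0 ≤ ∫ ω, ‖occupationFourier Y u v k ω‖ ^ (2 * n) ∂P :=
    integral_nonneg fun ω => by positivity
  have hFi : Integrable (fun ω => ‖occupationFourier Y u v k ω‖ ^ (2 * n)) P :=
    (memLp_occupationFourier hY.measurable u v hk ((2 * n : ℕ) : ℝ≥0∞)).integrable_norm_pow'
  have hL : ∫⁻ ω, ‖occupationFourier Y u v k ω‖ₑ ^ (2 * n) ∂P =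
      ‖∫ ω, (∫ z : Fin (2 * n) → ℝ × ℝ, ∏ j, occupationTerm Y u v k (z j) ω) ∂P‖ₑ := by
    simp_rw [← hpow, hreal]
    rw [integral_complex_ofReal, ← ofReal_norm, Complex.norm_real, Real.norm_of_nonneg hnn,
      ofReal_integral_eq_lintegral_ofReal hFi (ae_of_all _ fun ω => by positivity)]
    refine lintegral_congr fun ω => ?_
    rw [ENNReal.ofReal_pow (norm_nonneg _), ofReal_norm]
  rw [hL, integral_integral_swap hint]
  refine (enorm_integral_le_lintegral_enorm _).trans (lintegral_mono_ae ?_)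
  filter_upwards [hY.ae_integral_cexp_sum hX (2 * n)] with z hz
  simp_rw [prod_occupationTerm]
  rw [integral_const_mul, enorm_mul]
  by_cases h : ∀ j, (z j).1 ∈ Set.Ioc u v
  · rw [hz fun j => hu.trans (h j).1.le]
    refine mul_le_mul' (le_of_eq ?_) (le_of_eq ?_)
    · rw [← ofReal_norm, norm_prod, ENNReal.ofReal_prod_of_nonneg fun _ _ => norm_nonneg _]
      refine Finset.prod_congr rfl fun j _ => ?_
      rw [ofReal_norm, Set.indicator_of_mem (h j), Set.indicator_of_mem (h j)]
      simp
    · rw [← ofReal_norm, Complex.norm_real, Real.norm_of_nonneg (Real.exp_pos _).le]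
  · push Not at h
    obtain ⟨j, hj⟩ := h
    rw [Finset.prod_eq_zero (Finset.mem_univ j) (by rw [Set.indicator_of_notMem hj, zero_mul])]
    simp

end Moments

/-! ### The Gaussian kernel and its derivatives as Fourier integrals -/

lemma ofReal_gaussKernel {ε : ℝ} (hε : 0 < ε) (y : ℝ) :
    ((gaussKernel ε y : ℝ) : ℂ) = ∫ ξ : ℝ, 1 / (2 * (Real.pi : ℂ)) *
      ((Real.exp (-(ε / 2) * ξ ^ 2) : ℝ) : ℂ) * Complex.exp (Complex.I * ((ξ : ℂ) * (y : ℂ))) := by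
  have h := fourierIntegral_gaussian (b := ((ε / 2 : ℝ) : ℂ)) (by simpa using half_pos hε) (y : ℂ)
  have e : ∀ ξ : ℝ, 1 / (2 * (Real.pi : ℂ)) *
      ((Real.exp (-(ε / 2) * ξ ^ 2) : ℝ) : ℂ) * Complex.exp (Complex.I * ((ξ : ℂ) * (y : ℂ))) =
      1 / (2 * (Real.pi : ℂ)) * (Complex.exp (Complex.I * y * ξ) *
        Complex.exp (-((ε / 2 : ℝ) : ℂ) * (ξ : ℂ) ^ 2)) := by
    intro ξ
    rw [Complex.ofReal_exp]
    push_cast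
    ring_nf
  simp_rw [e]
  rw [integral_const_mul, h, gaussKernel]
  have hpi := Real.pi_pos
  have h1 : ((Real.pi : ℂ) / ((ε / 2 : ℝ) : ℂ)) ^ (1 / 2 : ℂ) =
      (((Real.pi / (ε / 2)) ^ (1 / 2 : ℝ) : ℝ) : ℂ) := by
    rw [Complex.ofReal_cpow (by positivity)]
    push_cast
    rfl
  have h2 : Complex.exp (-(y : ℂ) ^ 2 / (4 * ((ε / 2 : ℝ) : ℂ))) =
      ((Real.exp (-(1 / (2 * ε)) * y ^ 2) : ℝ) : ℂ) := by
    rw [Complex.ofReal_exp]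
    congr 1
    have : (ε : ℂ) ≠ 0 := by exact_mod_cast hε.ne'
    push_cast
    field_simp
    ring
  have h3 : (2 * Real.pi * ε) ^ (-(1 / 2 : ℝ)) =
      1 / (2 * Real.pi) * (Real.pi / (ε / 2)) ^ (1 / 2 : ℝ) := by
    rw [Real.rpow_neg (by positivity), ← Real.sqrt_eq_rpow, ← Real.sqrt_eq_rpow,
      show Real.pi / (ε / 2) = (2 * Real.pi) ^ 2 / (2 * Real.pi * ε) by field_simp,
      Real.sqrt_div (by positivity), Real.sqrt_sq (by positivity)]
    field_simp
  rw [h1, h2, h3]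
  push_cast
  ring

/-- The Fourier multiplier `(2π)⁻¹ (iξ)^ℓ e^{-iξx}`. Formally, `∫ derivSymbol ℓ x ξ * e^{iξy} dξ` is
the `ℓ`-th derivative of the Dirac mass, evaluated at `y - x`. -/
noncomputable def derivSymbol (ℓ : ℕ) (x ξ : ℝ) : ℂ :=
  1 / (2 * (Real.pi : ℂ)) * (Complex.I * (ξ : ℂ)) ^ ℓ * Complex.exp (-(Complex.I * (ξ * x : ℝ)))

lemma continuous_derivSymbol (ℓ : ℕ) (x : ℝ) : Continuous (derivSymbol ℓ x) := by
  unfold derivSymbol; fun_prop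

lemma norm_derivSymbol (ℓ : ℕ) (x ξ : ℝ) :
    ‖derivSymbol ℓ x ξ‖ = 1 / (2 * Real.pi) * |ξ| ^ ℓ := by
  have : ‖Complex.exp (-(Complex.I * (ξ * x : ℝ)))‖ = 1 := by
    rw [← mul_neg, mul_comm, ← Complex.ofReal_neg, Complex.norm_exp_ofReal_mul_I]
  rw [derivSymbol, norm_mul, this, norm_mul, norm_pow, norm_mul, Complex.norm_I, Complex.norm_real]
  simp [abs_of_pos Real.pi_pos]

lemma enorm_derivSymbol (ℓ : ℕ) (x ξ : ℝ) :
    ‖derivSymbol ℓ x ξ‖ₑ = ENNReal.ofReal (1 / (2 * Real.pi)) * ENNReal.ofReal (|ξ| ^ ℓ) := by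
  rw [← ofReal_norm, norm_derivSymbol, ENNReal.ofReal_mul (by positivity)]

/-- The multiplier of `y ↦ φ_ε^{(ℓ)}(y - x)`, with `φ_ε` the Gaussian kernel. -/
noncomputable def gaussSymbol (ℓ : ℕ) (ε x ξ : ℝ) : ℂ :=
  (Real.exp (-(ε / 2) * ξ ^ 2) : ℝ) * derivSymbol ℓ x ξ

lemma continuous_gaussSymbol (ℓ : ℕ) (ε x : ℝ) : Continuous (gaussSymbol ℓ ε x) := by
  have := continuous_derivSymbol ℓ x
  unfold gaussSymbol; fun_prop

lemma integrable_gaussSymbol (ℓ : ℕ) {ε : ℝ} (hε : 0 < ε) (x : ℝ) :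
    Integrable (gaussSymbol ℓ ε x) := by
  have := (integrable_rpow_mul_exp_neg_mul_sq (half_pos hε) (s := ℓ)
      (by linarith [Nat.cast_nonneg (α := ℝ) ℓ])).norm.const_mul (1 / (2 * Real.pi))
  refine this.mono' (continuous_gaussSymbol ℓ ε x).aestronglyMeasurable (ae_of_all _ fun ξ => ?_)
  rw [gaussSymbol, norm_mul, norm_derivSymbol, Complex.norm_real, norm_mul, Real.rpow_natCast,
    norm_pow, Real.norm_eq_abs ξ]
  exact le_of_eq (by ring)

lemma norm_gaussSymbol_le (ℓ : ℕ) {ε : ℝ} (hε : 0 ≤ ε) (x ξ : ℝ) :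
    ‖gaussSymbol ℓ ε x ξ‖ ≤ ‖derivSymbol ℓ x ξ‖ := by
  rw [gaussSymbol, norm_mul, Complex.norm_real, Real.norm_of_nonneg (Real.exp_pos _).le]
  refine mul_le_of_le_one_left (norm_nonneg _) (Real.exp_le_one_iff.2 ?_)
  have : 0 ≤ ξ ^ 2 := sq_nonneg _
  nlinarith

/-- Fourier inversion for the derivatives of the Gaussian kernel, by differentiation under the
integral sign. -/
lemma ofReal_iteratedDeriv_gaussKernel {ε : ℝ} (hε : 0 < ε) (ℓ : ℕ) : ∀ y : ℝ,
    ((iteratedDeriv ℓ (gaussKernel ε) y : ℝ) : ℂ) =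
      ∫ ξ : ℝ, gaussSymbol ℓ ε 0 ξ * Complex.exp (Complex.I * ((ξ : ℂ) * (y : ℂ))) := by
  have hone : ∀ ξ y : ℝ, ‖Complex.exp (Complex.I * ((ξ : ℂ) * (y : ℂ)))‖ = 1 := fun ξ y => by
    rw [mul_comm, ← Complex.ofReal_mul, Complex.norm_exp_ofReal_mul_I]
  induction ℓ with
  | zero =>
    intro y
    rw [iteratedDeriv_zero, ofReal_gaussKernel hε]
    refine integral_congr_ae (ae_of_all _ fun ξ => ?_)
    simp [gaussSymbol, derivSymbol]
    ring
  | succ ℓ ih =>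
    intro y
    have hd : HasDerivAt (fun y : ℝ => ∫ ξ : ℝ, gaussSymbol ℓ ε 0 ξ *
        Complex.exp (Complex.I * ((ξ : ℂ) * (y : ℂ))))
        (∫ ξ : ℝ, gaussSymbol (ℓ + 1) ε 0 ξ * Complex.exp (Complex.I * ((ξ : ℂ) * (y : ℂ)))) y := by
      have hc := continuous_gaussSymbol ℓ ε 0
      have hc' := continuous_gaussSymbol (ℓ + 1) ε 0
      refine (hasDerivAt_integral_of_dominated_loc_of_deriv_le
        (bound := fun ξ => ‖gaussSymbol (ℓ + 1) ε 0 ξ‖)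
        (F := fun (y : ℝ) ξ => gaussSymbol ℓ ε 0 ξ * Complex.exp (Complex.I * ((ξ : ℂ) * (y : ℂ))))
        (F' := fun (y : ℝ) ξ =>
          gaussSymbol (ℓ + 1) ε 0 ξ * Complex.exp (Complex.I * ((ξ : ℂ) * (y : ℂ))))
        (s := Set.univ) univ_mem ?_ ?_ ?_ ?_ ?_ ?_).2
      · exact Eventually.of_forall fun y => Continuous.aestronglyMeasurable (by fun_prop)
      · refine (integrable_gaussSymbol ℓ hε 0).mono (Continuous.aestronglyMeasurable (by fun_prop))
          (ae_of_all _ fun ξ => ?_)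
        rw [norm_mul, hone, mul_one]
      · exact Continuous.aestronglyMeasurable (by fun_prop)
      · exact ae_of_all _ fun ξ y _ => by rw [norm_mul, hone, mul_one]
      · exact (integrable_gaussSymbol (ℓ + 1) hε 0).norm
      · refine ae_of_all _ fun ξ y _ => ?_
        have h1 : HasDerivAt (fun y : ℝ => Complex.I * ((ξ : ℂ) * (y : ℂ)))
            (Complex.I * (ξ * 1)) y :=
          ((Complex.ofRealCLM.hasDerivAt (x := y)).const_mul (ξ : ℂ)).const_mul Complex.I
        have h2 := (h1.cexp).const_mul (gaussSymbol ℓ ε 0 ξ)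
        refine h2.congr_deriv ?_
        simp only [gaussSymbol, derivSymbol, pow_succ]
        ring
    have hfun : (fun y : ℝ => ∫ ξ : ℝ, gaussSymbol ℓ ε 0 ξ *
        Complex.exp (Complex.I * ((ξ : ℂ) * (y : ℂ)))) =
        fun y => ((iteratedDeriv ℓ (gaussKernel ε) y : ℝ) : ℂ) := funext fun y => (ih y).symm
    rw [hfun] at hd
    have hre : HasDerivAt (iteratedDeriv ℓ (gaussKernel ε)) (∫ ξ : ℝ, gaussSymbol (ℓ + 1) ε 0 ξ *
        Complex.exp (Complex.I * ((ξ : ℂ) * (y : ℂ)))).re y := by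
      have := Complex.reCLM.hasFDerivAt.comp_hasDerivAt y hd
      simpa [Function.comp_def] using this
    rw [iteratedDeriv_succ, hre.deriv]
    exact hre.ofReal_comp.unique hd

/-! ### Limits in the mean square -/

lemma momentIntegral_mono (H : ℝ) (m : ℕ) (u v : ℝ) {κ κ' : ℝ → ℝ≥0∞} (h : ∀ ξ, κ ξ ≤ κ' ξ) :
    momentIntegral H m u v κ ≤ momentIntegral H m u v κ' := by
  refine lintegral_mono fun z => mul_le_mul_left (Finset.prod_le_prod' fun j _ => ?_) _
  exact mul_le_mul_right (h _) _

lemma momentIntegral_const_mul (H : ℝ) (m : ℕ) (u v : ℝ) {c : ℝ≥0∞} (hc : c ≠ ⊤)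
    (κ : ℝ → ℝ≥0∞) :
    momentIntegral H m u v (fun ξ => c * κ ξ) = c ^ m * momentIntegral H m u v κ := by
  rw [momentIntegral, momentIntegral, ← lintegral_const_mul' _ _ (ENNReal.pow_ne_top hc)]
  refine lintegral_congr fun z => ?_
  rw [← mul_assoc]
  congr 1
  calc _ = ∏ j, c * ((Set.Ioc u v).indicator 1 (z j).1 * κ (z j).2) :=
        Finset.prod_congr rfl fun j _ => by ring
    _ = _ := by rw [Finset.prod_mul_distrib]; simp

lemma momentIntegral_self (H : ℝ) {m : ℕ} (hm : m ≠ 0) (u : ℝ) (κ : ℝ → ℝ≥0∞) :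
    momentIntegral H m u u κ = 0 := by
  rw [momentIntegral]
  obtain ⟨m, rfl⟩ := Nat.exists_eq_succ_of_ne_zero hm
  simp

lemma momentIntegral_zero (H : ℝ) {m : ℕ} (hm : m ≠ 0) (u v : ℝ) :
    momentIntegral H m u v (fun _ => 0) = 0 := by
  rw [momentIntegral]
  obtain ⟨m, rfl⟩ := Nat.exists_eq_succ_of_ne_zero hm
  simp

lemma measurable_momentIntegrand (H : ℝ) (m : ℕ) (u v : ℝ) {κ : ℝ → ℝ≥0∞} (hκ : Measurable κ) :
    Measurable fun z : Fin m → ℝ × ℝ => (∏ j, (Set.Ioc u v).indicator 1 (z j).1 * κ (z j).2) *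
      ENNReal.ofReal (Real.exp (-(fbmForm H (fun j => (z j).1) (fun j => (z j).2) / 2))) := by
  have h1 := measurable_fbmForm H m
  have h2 : Measurable ((Set.Ioc u v).indicator (1 : ℝ → ℝ≥0∞)) :=
    measurable_one.indicator measurableSet_Ioc
  refine Measurable.mul (Finset.measurable_fun_prod _ fun j _ => ?_) (by fun_prop)
  fun_prop

/-- Dominated convergence: pointwise convergence of multipliers under a common majorant with finite
moment integral gives convergence of the moment integrals. -/
lemma tendsto_momentIntegral {ι : Type*} {l : Filter ι} [l.IsCountablyGenerated] (H : ℝ) (m : ℕ)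
    (u v : ℝ) {E : ℝ → ℝ≥0∞} (hE : momentIntegral H m u v E ≠ ⊤)
    {k : ι → ℝ → ℂ} {k' : ℝ → ℂ} (hk : ∀ᶠ i in l, Measurable (k i))
    (hkE : ∀ᶠ i in l, ∀ ξ, ‖k i ξ‖ₑ ≤ E ξ) (hlim : ∀ ξ, Tendsto (fun i => k i ξ) l (𝓝 (k' ξ))) :
    Tendsto (fun i => momentIntegral H m u v fun ξ => ‖k i ξ‖ₑ) l
      (𝓝 (momentIntegral H m u v fun ξ => ‖k' ξ‖ₑ)) := by
  refine tendsto_lintegral_filter_of_dominated_convergence _ ?_ ?_ hE ?_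
  · filter_upwards [hk] with i hi
    exact measurable_momentIntegrand H m u v hi.enorm
  · filter_upwards [hkE] with i hi
    refine ae_of_all _ fun z => mul_le_mul_left (Finset.prod_le_prod' fun j _ => ?_) _
    exact mul_le_mul_right (hi _) _
  · refine ae_of_all _ fun z => ENNReal.Tendsto.mul_const ?_ (Or.inr ENNReal.ofReal_ne_top)
    have hind : ∀ s : ℝ, (Set.Ioc u v).indicator (1 : ℝ → ℝ≥0∞) s ≠ ⊤ := fun s => by
      by_cases h : s ∈ Set.Ioc u v <;> simp [h]
    refine ENNReal.tendsto_finsetProd_of_ne_top _ (fun j _ => ?_) fun j _ =>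
      ENNReal.mul_ne_top (hind _) enorm_ne_top
    exact ENNReal.Tendsto.const_mul (hlim _).enorm (Or.inr (hind _))

/-- Measurable integrable multipliers with Hermitian symmetry, i.e. those for which
`occupationFourier` is an absolutely convergent integral with real values. -/
structure IsHermitianMultiplier (k : ℝ → ℂ) : Prop where
  measurable : Measurable k
  integrable : Integrable k
  conj : ∀ ξ, k (-ξ) = starRingEnd ℂ (k ξ)

namespace IsHermitianMultiplier
variable {k k₁ k₂ : ℝ → ℂ}

lemma add (h₁ : IsHermitianMultiplier k₁) (h₂ : IsHermitianMultiplier k₂) :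
    IsHermitianMultiplier fun ξ => k₁ ξ + k₂ ξ :=
  ⟨h₁.measurable.add h₂.measurable, h₁.integrable.add h₂.integrable, fun ξ => by
    rw [h₁.conj, h₂.conj, map_add]⟩

lemma sub (h₁ : IsHermitianMultiplier k₁) (h₂ : IsHermitianMultiplier k₂) :
    IsHermitianMultiplier fun ξ => k₁ ξ - k₂ ξ :=
  ⟨h₁.measurable.sub h₂.measurable, h₁.integrable.sub h₂.integrable, fun ξ => by
    rw [h₁.conj, h₂.conj, map_sub]⟩

lemma const_mul (h : IsHermitianMultiplier k) (c : ℝ) :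
    IsHermitianMultiplier fun ξ => (c : ℂ) * k ξ :=
  ⟨h.measurable.const_mul _, h.integrable.const_mul _, fun ξ => by
    rw [h.conj, map_mul, Complex.conj_ofReal]⟩

end IsHermitianMultiplier

section L2
variable {Ω : Type*} [MeasurableSpace Ω] {P : Measure Ω} {Y : ℝ → Ω → ℝ}

lemma occupationFourier_add (hY : Measurable fun q : ℝ × Ω => Y q.1 q.2) (u v : ℝ) {k₁ k₂ : ℝ → ℂ}
    (h₁ : IsHermitianMultiplier k₁) (h₂ : IsHermitianMultiplier k₂) (ω : Ω) :
    occupationFourier Y u v (fun ξ => k₁ ξ + k₂ ξ) ω =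
      occupationFourier Y u v k₁ ω + occupationFourier Y u v k₂ ω := by
  rw [occupationFourier, occupationFourier, occupationFourier, ← integral_add
    (integrable_occupationTerm hY u v h₁.measurable h₁.integrable ω)
    (integrable_occupationTerm hY u v h₂.measurable h₂.integrable ω)]
  exact integral_congr_ae (ae_of_all _ fun q => by simp only [occupationTerm]; ring)

lemma occupationFourier_sub (hY : Measurable fun q : ℝ × Ω => Y q.1 q.2) (u v : ℝ) {k₁ k₂ : ℝ → ℂ}
    (h₁ : IsHermitianMultiplier k₁) (h₂ : IsHermitianMultiplier k₂) (ω : Ω) :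
    occupationFourier Y u v (fun ξ => k₁ ξ - k₂ ξ) ω =
      occupationFourier Y u v k₁ ω - occupationFourier Y u v k₂ ω := by
  rw [occupationFourier, occupationFourier, occupationFourier, ← integral_sub
    (integrable_occupationTerm hY u v h₁.measurable h₁.integrable ω)
    (integrable_occupationTerm hY u v h₂.measurable h₂.integrable ω)]
  exact integral_congr_ae (ae_of_all _ fun q => by simp only [occupationTerm]; ring)

lemma occupationFourier_interval_sub (hY : Measurable fun q : ℝ × Ω => Y q.1 q.2) {a u v : ℝ}
    (hau : a ≤ u) (huv : u ≤ v) {k : ℝ → ℂ} (hk : IsHermitianMultiplier k) (ω : Ω) :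
    occupationFourier Y a v k ω - occupationFourier Y a u k ω = occupationFourier Y u v k ω := by
  rw [occupationFourier, occupationFourier, occupationFourier, ← integral_sub
    (integrable_occupationTerm hY a v hk.measurable hk.integrable ω)
    (integrable_occupationTerm hY a u hk.measurable hk.integrable ω)]
  refine integral_congr_ae (ae_of_all _ fun q => ?_)
  simp only [occupationTerm]
  rw [mul_assoc, mul_assoc, mul_assoc, ← sub_mul]
  congr 1
  rw [← Set.Ioc_union_Ioc_eq_Ioc hau huv, Set.indicator_union_of_disjoint]
  · simp
  · exact Set.Ioc_disjoint_Ioc_of_le le_rfl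

variable [IsProbabilityMeasure P] {H : ℝ} {X : ℝ≥0 → Ω → ℝ}

lemma eLpNorm_occupationFourier_le (hX : IsFractionalBrownianMotion H X P)
    (hY : IsMeasurableVersion P X Y) {u v : ℝ} (hu : 0 ≤ u) {k : ℝ → ℂ}
    (hk : IsHermitianMultiplier k) {n : ℕ} (hn : n ≠ 0) :
    eLpNorm (occupationFourier Y u v k) ((2 * n : ℕ) : ℝ≥0∞) P ≤
      momentIntegral H (2 * n) u v (fun ξ => ‖k ξ‖ₑ) ^ (1 / ((2 * n : ℕ) : ℝ)) := by
  rw [eLpNorm_eq_lintegral_rpow_enorm_toReal (by simpa using hn) (ENNReal.natCast_ne_top _),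
    ENNReal.toReal_natCast]
  refine ENNReal.rpow_le_rpow ?_ (by positivity)
  simp_rw [ENNReal.rpow_natCast]
  exact lintegral_enorm_occupationFourier_pow_le hX hY hu hk.measurable hk.integrable hk.conj n

lemma eLpNorm_two_occupationFourier_le (hX : IsFractionalBrownianMotion H X P)
    (hY : IsMeasurableVersion P X Y) {u v : ℝ} (hu : 0 ≤ u) {k : ℝ → ℂ}
    (hk : IsHermitianMultiplier k) :
    eLpNorm (occupationFourier Y u v k) 2 P ≤
      momentIntegral H 2 u v (fun ξ => ‖k ξ‖ₑ) ^ (1 / 2 : ℝ) := by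
  simpa using eLpNorm_occupationFourier_le hX hY hu hk one_ne_zero

/-- If Hermitian multipliers converge pointwise to `k'` under a majorant `E` with finite second
moment integral, the random variables converge in `L²`. The limit `Z` plays the role of
`occupationFourier Y u v k'`, though `k'` need not be integrable: its distance to the variable of
any Hermitian multiplier `k` below `E` is controlled by the moment integral of `k - k'`. -/
theorem exists_L2_limit_occupationFourier (hX : IsFractionalBrownianMotion H X P)
    (hY : IsMeasurableVersion P X Y) {u v : ℝ} (hu : 0 ≤ u) {k' : ℝ → ℂ} {E : ℝ → ℝ≥0∞}
    (hE : momentIntegral H 2 u v E ≠ ⊤) (K : ℕ → ℝ → ℂ) (hK : ∀ n, IsHermitianMultiplier (K n))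
    (hKE : ∀ n ξ, ‖K n ξ‖ₑ ≤ E ξ) (hlim : ∀ ξ, Tendsto (fun n => K n ξ) atTop (𝓝 (k' ξ))) :
    ∃ Z : Ω → ℝ, MemLp Z 2 P ∧ ∀ k, IsHermitianMultiplier k → (∀ ξ, ‖k ξ‖ₑ ≤ E ξ) →
      eLpNorm (fun ω => occupationFourier Y u v k ω - (Z ω : ℂ)) 2 P ≤
        momentIntegral H 2 u v (fun ξ => ‖k ξ - k' ξ‖ₑ) ^ (1 / 2 : ℝ) := by
  have hE2 : momentIntegral H 2 u v (fun ξ => 2 * E ξ) ≠ ⊤ := by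
    rw [momentIntegral_const_mul _ _ _ _ ENNReal.ofNat_ne_top]
    exact ENNReal.mul_ne_top (ENNReal.pow_ne_top ENNReal.ofNat_ne_top) hE
  have hsubE : ∀ {a b : ℂ} {ξ : ℝ}, ‖a‖ₑ ≤ E ξ → ‖b‖ₑ ≤ E ξ → ‖a - b‖ₑ ≤ 2 * E ξ := by
    intro a b ξ ha hb
    rw [two_mul]
    exact enorm_sub_le.trans (add_le_add ha hb)
  have hrpow : Tendsto (fun x : ℝ≥0∞ => x ^ (1 / 2 : ℝ)) (𝓝 0) (𝓝 0) := by
    have := (ENNReal.continuous_rpow_const (y := 1 / 2)).tendsto 0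
    rwa [ENNReal.zero_rpow_of_pos (by norm_num)] at this
  have hL := fun n => memLp_occupationFourier (P := P) hY.measurable u v (hK n).measurable 2
  have hdist : ∀ n m, edist ((hL n).toLp) ((hL m).toLp) ≤
      momentIntegral H 2 u v (fun ξ => ‖K n ξ - K m ξ‖ₑ) ^ (1 / 2 : ℝ) := by
    intro n m
    rw [Lp.edist_toLp_toLp]
    refine le_of_eq_of_le ?_ (eLpNorm_two_occupationFourier_le hX hY hu ((hK n).sub (hK m)))
    congr 1
    ext ω
    rw [occupationFourier_sub hY.measurable u v (hK n) (hK m)]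
    rfl
  have hcau : CauchySeq fun n => (hL n).toLp := by
    rw [EMetric.cauchySeq_iff]
    intro ε hε
    have h1 : Tendsto (fun p : ℕ × ℕ => momentIntegral H 2 u v fun ξ => ‖K p.1 ξ - K p.2 ξ‖ₑ)
        atTop (𝓝 0) := by
      have := tendsto_momentIntegral (l := (atTop : Filter (ℕ × ℕ))) H 2 u v hE2
        (k := fun p ξ => K p.1 ξ - K p.2 ξ) (k' := fun _ => 0)
        (Eventually.of_forall fun p => (hK p.1).measurable.sub (hK p.2).measurable)
        (Eventually.of_forall fun p ξ => hsubE (hKE _ _) (hKE _ _)) fun ξ => by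
          rw [← prod_atTop_atTop_eq, ← sub_self (k' ξ)]
          exact ((hlim ξ).comp tendsto_fst).sub ((hlim ξ).comp tendsto_snd)
      simpa [momentIntegral_zero] using this
    obtain ⟨N, hN⟩ := eventually_atTop.1 ((hrpow.comp h1).eventually (gt_mem_nhds hε))
    refine ⟨max N.1 N.2, fun m hm n hn => (hdist m n).trans_lt (hN (m, n) ⟨?_, ?_⟩)⟩
    · exact (le_max_left _ _).trans hm
    · exact (le_max_right _ _).trans hn
  obtain ⟨Zc, hZc⟩ := cauchySeq_tendsto_of_complete hcau
  refine ⟨fun ω => (Zc ω).re, (Lp.memLp Zc).re, fun k hk hkE => ?_⟩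
  have hZm : AEStronglyMeasurable (fun ω => (((Zc ω).re : ℝ) : ℂ)) P :=
    (Lp.memLp Zc).re.ofReal.aestronglyMeasurable
  have hconv : Tendsto (fun n => eLpNorm (fun ω => occupationFourier Y u v (K n) ω -
      (((Zc ω).re : ℝ) : ℂ)) 2 P) atTop (𝓝 0) := by
    have h1 := (Lp.tendsto_Lp_iff_tendsto_eLpNorm' _ _).1 hZc
    refine tendsto_of_tendsto_of_tendsto_of_le_of_le tendsto_const_nhds h1 (fun _ => zero_le)
      fun n => eLpNorm_mono_ae ?_
    filter_upwards [(hL n).coeFn_toLp] with ω hω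
    obtain ⟨r, hr⟩ := Complex.conj_eq_iff_real.1
      (conj_occupationFourier (Y := Y) u v (hK n).conj ω)
    simp only [Pi.sub_apply, hω, hr]
    rw [← Complex.ofReal_sub, Complex.norm_real]
    have := Complex.abs_re_le_norm ((r : ℂ) - Zc ω)
    simpa using this
  have hB : Tendsto (fun n => momentIntegral H 2 u v (fun ξ => ‖k ξ - K n ξ‖ₑ) ^ (1 / 2 : ℝ) +
      eLpNorm (fun ω => occupationFourier Y u v (K n) ω - (((Zc ω).re : ℝ) : ℂ)) 2 P) atTop
      (𝓝 (momentIntegral H 2 u v (fun ξ => ‖k ξ - k' ξ‖ₑ) ^ (1 / 2 : ℝ) + 0)) := by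
    refine Tendsto.add ?_ hconv
    refine ((ENNReal.continuous_rpow_const (y := 1 / 2)).tendsto _).comp ?_
    exact tendsto_momentIntegral H 2 u v hE2
      (Eventually.of_forall fun n => hk.measurable.sub (hK n).measurable)
      (Eventually.of_forall fun n ξ => hsubE (hkE ξ) (hKE n ξ))
      fun ξ => tendsto_const_nhds.sub (hlim ξ)
  rw [add_zero] at hB
  refine ge_of_tendsto' hB fun n => ?_
  have h2 := eLpNorm_two_occupationFourier_le hX hY hu (v := v) (hk.sub (hK n))
  refine le_trans ?_ (add_le_add_left h2 _)
  refine le_of_eq_of_le ?_ (eLpNorm_add_le ?_ ?_ one_le_two)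
  · congr 1
    ext ω
    simp only [Pi.add_apply]
    rw [occupationFourier_sub hY.measurable u v hk (hK n)]
    ring
  · exact (memLp_occupationFourier (P := P) hY.measurable u v
      (hk.sub (hK n)).measurable 2).aestronglyMeasurable
  · exact (hL n).aestronglyMeasurable.sub hZm

end L2

/-! ### Existence of the derivatives of the local time -/

lemma derivSymbol_neg (ℓ : ℕ) (x ξ : ℝ) :
    derivSymbol ℓ x (-ξ) = starRingEnd ℂ (derivSymbol ℓ x ξ) := by
  simp only [derivSymbol, map_mul, map_pow, map_div₀, map_one, map_ofNat, Complex.conj_ofReal,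
    Complex.conj_I, ← Complex.exp_conj, map_neg]
  push_cast
  congr 2
  · ring
  · ring

lemma isHermitianMultiplier_gaussSymbol (ℓ : ℕ) {ε : ℝ} (hε : 0 < ε) (x : ℝ) :
    IsHermitianMultiplier (gaussSymbol ℓ ε x) :=
  ⟨(continuous_gaussSymbol ℓ ε x).measurable, integrable_gaussSymbol ℓ hε x, fun ξ => by
    rw [gaussSymbol, gaussSymbol, derivSymbol_neg, map_mul, Complex.conj_ofReal, neg_sq]⟩

/-- The multiplier `derivSymbol`, truncated to frequencies in `[-N, N]`. -/
noncomputable def cutoffSymbol (ℓ : ℕ) (N x : ℝ) : ℝ → ℂ :=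
  (Set.Icc (-N) N).indicator (derivSymbol ℓ x)

lemma isHermitianMultiplier_cutoffSymbol (ℓ : ℕ) (N x : ℝ) :
    IsHermitianMultiplier (cutoffSymbol ℓ N x) := by
  refine ⟨(continuous_derivSymbol ℓ x).measurable.indicator measurableSet_Icc, ?_, fun ξ => ?_⟩
  · rw [cutoffSymbol, integrable_indicator_iff measurableSet_Icc]
    exact (continuous_derivSymbol ℓ x).continuousOn.integrableOn_compact isCompact_Icc
  · have : -ξ ∈ Set.Icc (-N) N ↔ ξ ∈ Set.Icc (-N) N := by
      simp only [Set.mem_Icc]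
      constructor <;> rintro ⟨h1, h2⟩ <;> constructor <;> linarith
    by_cases h : ξ ∈ Set.Icc (-N) N
    · rw [cutoffSymbol, Set.indicator_of_mem h, Set.indicator_of_mem (this.2 h), derivSymbol_neg]
    · rw [cutoffSymbol, Set.indicator_of_notMem h, Set.indicator_of_notMem (mt this.1 h), map_zero]

lemma norm_cutoffSymbol_le (ℓ : ℕ) (N x ξ : ℝ) : ‖cutoffSymbol ℓ N x ξ‖ ≤ ‖derivSymbol ℓ x ξ‖ :=
  norm_indicator_le_norm_self _ _

lemma tendsto_cutoffSymbol (ℓ : ℕ) (x ξ : ℝ) :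
    Tendsto (fun N => cutoffSymbol ℓ N x ξ) atTop (𝓝 (derivSymbol ℓ x ξ)) := by
  refine tendsto_const_nhds.congr' ?_
  filter_upwards [eventually_ge_atTop |ξ|] with N hN
  rw [cutoffSymbol, Set.indicator_of_mem (Set.mem_Icc.2 (abs_le.1 hN))]

lemma tendsto_gaussSymbol (ℓ : ℕ) (x ξ : ℝ) :
    Tendsto (fun ε => gaussSymbol ℓ ε x ξ) (𝓝[>] 0) (𝓝 (derivSymbol ℓ x ξ)) := by
  have : Continuous fun ε => gaussSymbol ℓ ε x ξ := by unfold gaussSymbol; fun_prop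
  have h := this.tendsto 0
  simp only [gaussSymbol, zero_div, neg_zero, zero_mul, Real.exp_zero, Complex.ofReal_one,
    one_mul] at h
  exact h.mono_left nhdsWithin_le_nhds

lemma momentIntegral_derivSymbol_ne_top {H : ℝ} (hH0 : 0 < H) {ℓ : ℕ}
    (hH : H * (2 * ℓ + 1) < 1) {m : ℕ} (hm : m ≠ 0) {u v : ℝ} (hu : 0 ≤ u) (huv : u ≤ v) (x : ℝ) :
    momentIntegral H m u v (fun ξ => ‖derivSymbol ℓ x ξ‖ₑ) ≠ ⊤ := by
  rcases huv.eq_or_lt with rfl | huv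
  · rw [momentIntegral_self H hm]; exact ENNReal.zero_ne_top
  obtain ⟨C, hC⟩ := exists_momentIntegral_le hH0 hH m
  simp_rw [enorm_derivSymbol]
  rw [momentIntegral_const_mul _ _ _ _ ENNReal.ofReal_ne_top]
  refine ENNReal.mul_ne_top (ENNReal.pow_ne_top ENNReal.ofReal_ne_top)
    (ne_top_of_le_ne_top ?_ (hC u v hu huv))
  exact ENNReal.mul_ne_top ENNReal.coe_ne_top ENNReal.ofReal_ne_top

section Approximations
variable {Ω : Type*} [MeasurableSpace Ω] {P : Measure Ω} {X : ℝ≥0 → Ω → ℝ} {Y : ℝ → Ω → ℝ}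

lemma ofReal_localTimeDerivApprox_ae_eq (hY : IsMeasurableVersion P X Y) (ℓ : ℕ) {ε : ℝ}
    (hε : 0 < ε) (t : ℝ≥0) (x : ℝ) :
    (fun ω => ((localTimeDerivApprox X ℓ ε t x ω : ℝ) : ℂ)) =ᵐ[P]
      occupationFourier Y 0 t (gaussSymbol ℓ ε x) := by
  filter_upwards [hY.ae_ae_eq] with ω hω
  have hg := isHermitianMultiplier_gaussSymbol ℓ hε x
  rw [occupationFourier, Measure.volume_eq_prod, integral_prod _
    (integrable_occupationTerm hY.measurable 0 t hg.measurable hg.integrable ω),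
    localTimeDerivApprox, intervalIntegral.integral_of_le (NNReal.coe_nonneg t),
    ← integral_complex_ofReal, ← integral_indicator measurableSet_Ioc]
  refine integral_congr_ae ?_
  filter_upwards [hω] with s hs
  by_cases h : s ∈ Set.Ioc (0 : ℝ) t
  · rw [Set.indicator_of_mem h, ofReal_iteratedDeriv_gaussKernel hε, hs]
    refine integral_congr_ae (ae_of_all _ fun ξ => ?_)
    simp only [occupationTerm, gaussSymbol, derivSymbol, Set.indicator_of_mem h, Pi.one_apply,
      one_mul, mul_assoc, ← Complex.exp_add]
    congr 4
    push_cast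
    ring
  · simp [occupationTerm, h]

lemma localTimeDerivFourier_ae_eq (hY : IsMeasurableVersion P X Y) (ℓ : ℕ) {N : ℝ}
    (hN : 0 ≤ N) (t : ℝ≥0) (x : ℝ) :
    localTimeDerivFourier X ℓ N t x =ᵐ[P] occupationFourier Y 0 t (cutoffSymbol ℓ N x) := by
  filter_upwards [hY.ae_ae_eq] with ω hω
  have hg := isHermitianMultiplier_cutoffSymbol ℓ N x
  rw [occupationFourier, Measure.volume_eq_prod, integral_prod_symm _
    (integrable_occupationTerm hY.measurable 0 t hg.measurable hg.integrable ω),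
    localTimeDerivFourier, intervalIntegral.integral_of_le (by linarith), ← integral_const_mul,
    ← integral_Icc_eq_integral_Ioc, ← integral_indicator measurableSet_Icc]
  refine integral_congr_ae (ae_of_all _ fun ξ => ?_)
  by_cases h : ξ ∈ Set.Icc (-N) N
  · simp only [Set.indicator_of_mem h]
    rw [intervalIntegral.integral_of_le (NNReal.coe_nonneg t), ← integral_const_mul,
      ← integral_indicator measurableSet_Ioc]
    refine integral_congr_ae ?_
    filter_upwards [hω] with s hs
    by_cases h' : s ∈ Set.Ioc (0 : ℝ) t
    · rw [Set.indicator_of_mem h', hs]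
      simp only [occupationTerm, cutoffSymbol, derivSymbol, Set.indicator_of_mem h,
        Set.indicator_of_mem h', Pi.one_apply, one_mul, mul_assoc, ← Complex.exp_add]
      congr 4
      push_cast
      ring
    · simp [occupationTerm, h']
  · simp [occupationTerm, cutoffSymbol, h]

lemma tendsto_eLpNorm_occupationFourier_cutoff (hY : IsMeasurableVersion P X Y) {ℓ : ℕ} {t : ℝ≥0}
    {x : ℝ} {Z : Ω → ℝ} (h : TendstoInL2 P (fun N : ℝ => localTimeDerivFourier X ℓ N t x) atTop
      (fun ω => (Z ω : ℂ))) :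
    Tendsto (fun N => eLpNorm (fun ω => occupationFourier Y 0 t (cutoffSymbol ℓ N x) ω - (Z ω : ℂ))
      2 P) atTop (𝓝 0) := by
  refine h.2.2.congr' ?_
  filter_upwards [eventually_ge_atTop 0] with N hN
  refine eLpNorm_congr_ae ?_
  filter_upwards [localTimeDerivFourier_ae_eq hY ℓ hN t x] with ω hω
  rw [hω]

variable [IsProbabilityMeasure P] {H : ℝ}

/-- Both approximations converge to the same limit, since both multipliers converge pointwise to
`derivSymbol` and are dominated by it. -/
theorem exists_localTimeDeriv (hX : IsFractionalBrownianMotion H X P)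
    (hY : IsMeasurableVersion P X Y) (hH0 : 0 < H) {ℓ : ℕ} (hH : H * (2 * ℓ + 1) < 1) (t : ℝ≥0)
    (x : ℝ) : ∃ Z : Ω → ℝ,
      TendstoInL2 P (fun ε : ℝ => localTimeDerivApprox X ℓ ε t x) (𝓝[>] 0) Z ∧
      TendstoInL2 P (fun N : ℝ => localTimeDerivFourier X ℓ N t x) atTop (fun ω => (Z ω : ℂ)) := by
  have hE := momentIntegral_derivSymbol_ne_top hH0 hH two_ne_zero le_rfl (NNReal.coe_nonneg t) x
  have hcE : ∀ (N : ℝ) ξ, ‖cutoffSymbol ℓ N x ξ‖ₑ ≤ ‖derivSymbol ℓ x ξ‖ₑ := fun N ξ =>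
    enorm_le_iff_norm_le.2 (norm_cutoffSymbol_le ℓ N x ξ)
  obtain ⟨Z, hZ, hZk⟩ := exists_L2_limit_occupationFourier hX hY le_rfl
    (k' := derivSymbol ℓ x) hE
    (fun n : ℕ => cutoffSymbol ℓ n x) (fun n => isHermitianMultiplier_cutoffSymbol ℓ n x)
    (fun n ξ => hcE n ξ)
    (fun ξ => (tendsto_cutoffSymbol ℓ x ξ).comp tendsto_natCast_atTop_atTop)
  have key : ∀ {l : Filter ℝ} [l.IsCountablyGenerated] (k : ℝ → ℝ → ℂ),
      (∀ᶠ i in l, IsHermitianMultiplier (k i)) →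
      (∀ᶠ i in l, ∀ ξ, ‖k i ξ‖ ≤ ‖derivSymbol ℓ x ξ‖) →
      (∀ ξ, Tendsto (fun i => k i ξ) l (𝓝 (derivSymbol ℓ x ξ))) →
      Tendsto (fun i => eLpNorm (fun ω => occupationFourier Y 0 t (k i) ω - (Z ω : ℂ)) 2 P) l
        (𝓝 0) := by
    intro l _ k hk hkE hlim
    have hE2 : momentIntegral H 2 0 t (fun ξ => 2 * ‖derivSymbol ℓ x ξ‖ₑ) ≠ ⊤ := by
      rw [momentIntegral_const_mul _ _ _ _ ENNReal.ofNat_ne_top]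
      exact ENNReal.mul_ne_top (ENNReal.pow_ne_top ENNReal.ofNat_ne_top) hE
    have h1 := tendsto_momentIntegral H 2 0 t hE2 (k := fun i ξ => k i ξ - derivSymbol ℓ x ξ)
      (k' := fun _ => 0) (l := l)
      (hk.mono fun i hi => hi.measurable.sub (continuous_derivSymbol ℓ x).measurable)
      (hkE.mono fun i hi ξ => by
        rw [two_mul]
        exact enorm_sub_le.trans (add_le_add_left (enorm_le_iff_norm_le.2 (hi ξ)) _))
      (fun ξ => by simpa using (hlim ξ).sub_const (derivSymbol ℓ x ξ))
    simp only [enorm_zero, momentIntegral_zero H two_ne_zero] at h1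
    have h2 := ((ENNReal.continuous_rpow_const (y := 1 / 2)).tendsto 0).comp h1
    rw [ENNReal.zero_rpow_of_pos (by norm_num)] at h2
    refine tendsto_of_tendsto_of_tendsto_of_le_of_le' tendsto_const_nhds h2
      (Eventually.of_forall fun _ => zero_le) ?_
    filter_upwards [hk, hkE] with i hi hiE
    exact hZk (k i) hi fun ξ => enorm_le_iff_norm_le.2 (hiE ξ)
  refine ⟨Z, ⟨?_, hZ, ?_⟩, ⟨?_, hZ.ofReal, ?_⟩⟩
  · filter_upwards [self_mem_nhdsWithin] with ε hε
    have h1 := (memLp_occupationFourier (P := P) hY.measurable 0 t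
      (isHermitianMultiplier_gaussSymbol ℓ hε x).measurable 2).ae_eq
      (ofReal_localTimeDerivApprox_ae_eq hY ℓ hε t x).symm
    simpa using h1.re
  · refine (key (l := 𝓝[>] 0) (fun ε => gaussSymbol ℓ ε x) ?_ ?_
      (tendsto_gaussSymbol ℓ x)).congr' ?_
    · filter_upwards [self_mem_nhdsWithin] with ε hε
      exact isHermitianMultiplier_gaussSymbol ℓ hε x
    · filter_upwards [self_mem_nhdsWithin] with ε hε ξ
      exact norm_gaussSymbol_le ℓ (le_of_lt hε) x ξ
    · filter_upwards [self_mem_nhdsWithin] with ε hε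
      refine eLpNorm_congr_norm_ae ?_
      filter_upwards [ofReal_localTimeDerivApprox_ae_eq hY ℓ hε t x] with ω hω
      rw [← hω, ← Complex.ofReal_sub, Complex.norm_real]
  · filter_upwards [eventually_ge_atTop 0] with N hN
    exact (memLp_occupationFourier (P := P) hY.measurable 0 t
      (isHermitianMultiplier_cutoffSymbol ℓ N x).measurable 2).ae_eq
      (localTimeDerivFourier_ae_eq hY ℓ hN t x).symm
  · refine (key (l := atTop) (fun N => cutoffSymbol ℓ N x)
      (Eventually.of_forall fun N => isHermitianMultiplier_cutoffSymbol ℓ N x)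
      (Eventually.of_forall fun N ξ => norm_cutoffSymbol_le ℓ N x ξ)
      (tendsto_cutoffSymbol ℓ x)).congr' ?_
    filter_upwards [eventually_ge_atTop 0] with N hN
    refine eLpNorm_congr_ae ?_
    filter_upwards [localTimeDerivFourier_ae_eq hY ℓ hN t x] with ω hω
    rw [hω]

end Approximations

/-! ### Difference quotients in space and increments in time -/

lemma derivSymbol_add (ℓ : ℕ) (x h ξ : ℝ) :
    derivSymbol ℓ (x + h) ξ =
      derivSymbol ℓ x ξ * Complex.exp (Complex.I * ((-(ξ * h) : ℝ) : ℂ)) := by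
  simp only [derivSymbol]
  rw [mul_assoc _ (Complex.exp _), ← Complex.exp_add]
  congr 2
  push_cast
  ring

lemma derivSymbol_succ (ℓ : ℕ) (x ξ : ℝ) :
    derivSymbol (ℓ + 1) x ξ = derivSymbol ℓ x ξ * (Complex.I * ξ) := by
  simp only [derivSymbol, pow_succ]
  ring

/-- The multiplier of the error `h⁻¹ (L^{(ℓ)}(x + h) - L^{(ℓ)}(x)) + L^{(ℓ+1)}(x)` of the difference
quotient in space. -/
noncomputable def quotientSymbol (ℓ : ℕ) (x h ξ : ℝ) : ℂ :=
  ((1 / h : ℝ) : ℂ) * (derivSymbol ℓ (x + h) ξ - derivSymbol ℓ x ξ) + derivSymbol (ℓ + 1) x ξ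

lemma measurable_quotientSymbol (ℓ : ℕ) (x h : ℝ) : Measurable (quotientSymbol ℓ x h) := by
  have h1 := (continuous_derivSymbol ℓ (x + h)).measurable
  have h2 := (continuous_derivSymbol ℓ x).measurable
  have h3 := (continuous_derivSymbol (ℓ + 1) x).measurable
  unfold quotientSymbol
  fun_prop

/-- The elementary inequality `|e^{-iξh} - 1| ≤ |ξh|`; it makes `2 * |derivSymbol (ℓ + 1) x|` a
majorant that is uniform in `h`. -/
lemma norm_quotientSymbol_le (ℓ : ℕ) (x h ξ : ℝ) :
    ‖quotientSymbol ℓ x h ξ‖ ≤ 2 * ‖derivSymbol (ℓ + 1) x ξ‖ := by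
  rw [quotientSymbol, derivSymbol_add, two_mul]
  refine (norm_add_le _ _).trans (add_le_add_left ?_ _)
  rw [← mul_sub_one, norm_mul, norm_mul, derivSymbol_succ, norm_mul, norm_mul, Complex.norm_I,
    one_mul, Complex.norm_real, Complex.norm_real, mul_left_comm]
  refine mul_le_mul_of_nonneg_left ?_ (norm_nonneg _)
  have h1 := Real.norm_exp_I_mul_ofReal_sub_one_le (x := -(ξ * h))
  rw [norm_neg, norm_mul] at h1
  rcases eq_or_ne h 0 with rfl | hh
  · simp
  calc ‖1 / h‖ * _ ≤ ‖1 / h‖ * (‖ξ‖ * ‖h‖) := by gcongr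
    _ = ‖ξ‖ := by
      have : ‖h‖ ≠ 0 := norm_ne_zero_iff.2 hh
      rw [norm_div, norm_one]
      field_simp

lemma tendsto_quotientSymbol (ℓ : ℕ) (x ξ : ℝ) :
    Tendsto (fun h => quotientSymbol ℓ x h ξ) (𝓝[≠] 0) (𝓝 0) := by
  have hd : HasDerivAt (fun y : ℝ => derivSymbol ℓ y ξ) (-derivSymbol (ℓ + 1) x ξ) x := by
    have h1 : HasDerivAt (fun y : ℝ => -(Complex.I * ((ξ * y : ℝ) : ℂ))) (-(Complex.I * (ξ : ℂ)))
        x := by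
      have h0 := ((hasDerivAt_id x).const_mul ξ).ofReal_comp
      simpa using (h0.const_mul Complex.I).fun_neg
    have h2 := h1.cexp.const_mul (1 / (2 * (Real.pi : ℂ)) * (Complex.I * (ξ : ℂ)) ^ ℓ)
    refine h2.congr_deriv ?_
    simp only [derivSymbol, pow_succ]
    ring
  have h3 := (hasDerivAt_iff_tendsto_slope_zero.1 hd).add_const (derivSymbol (ℓ + 1) x ξ)
  rw [neg_add_cancel] at h3
  refine h3.congr fun h => ?_
  rw [quotientSymbol, Complex.real_smul, one_div]

lemma memLp_of_memLp_ofReal {Ω : Type*} [MeasurableSpace Ω] {P : Measure Ω} {Z : Ω → ℝ}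
    {p : ℝ≥0∞} (h : MemLp (fun ω => (Z ω : ℂ)) p P) : MemLp Z p P := by
  simpa using h.re

section Increments
variable {Ω : Type*} [MeasurableSpace Ω] {P : Measure Ω} [IsProbabilityMeasure P]
  {X : ℝ≥0 → Ω → ℝ} {Y : ℝ → Ω → ℝ} {H : ℝ}

/-- The limits in `L²` of the truncated variables satisfy the bound that holds, uniformly in the
truncation `N`, for the combination of the truncated variables. -/
lemma eLpNorm_difference_quotient_le (hX : IsFractionalBrownianMotion H X P)
    (hY : IsMeasurableVersion P X Y) {ℓ : ℕ} (t : ℝ≥0) (x h : ℝ)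
    {Z₀ : ℝ → Ω → ℝ} {Z₁ : Ω → ℝ}
    (h₀ : ∀ y, TendstoInL2 P (fun N : ℝ => localTimeDerivFourier X ℓ N t y) atTop
      (fun ω => (Z₀ y ω : ℂ)))
    (h₁ : TendstoInL2 P (fun N : ℝ => localTimeDerivFourier X (ℓ + 1) N t x) atTop
      (fun ω => (Z₁ ω : ℂ))) :
    eLpNorm (fun ω => 1 / h * (Z₀ (x + h) ω - Z₀ x ω) - -Z₁ ω) 2 P ≤
      momentIntegral H 2 0 t (fun ξ => ‖quotientSymbol ℓ x h ξ‖ₑ) ^ (1 / 2 : ℝ) := by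
  have hc := fun (m : ℕ) (N y : ℝ) => isHermitianMultiplier_cutoffSymbol m N y
  have hFm := fun (m : ℕ) (N y : ℝ) =>
    memLp_occupationFourier (P := P) hY.measurable 0 t (hc m N y).measurable 2
  -- the truncation of `quotientSymbol`
  set κ : ℝ → ℝ → ℂ := fun N ξ => ((1 / h : ℝ) : ℂ) *
    (cutoffSymbol ℓ N (x + h) ξ - cutoffSymbol ℓ N x ξ) + cutoffSymbol (ℓ + 1) N x ξ with hκ
  have hκh : ∀ N, IsHermitianMultiplier (κ N) := fun N =>
    (((hc ℓ N (x + h)).sub (hc ℓ N x)).const_mul _).add (hc (ℓ + 1) N x)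
  have hκle : ∀ N ξ, ‖κ N ξ‖ ≤ ‖quotientSymbol ℓ x h ξ‖ := by
    intro N ξ
    by_cases hξ : ξ ∈ Set.Icc (-N) N
    · simp [hκ, cutoffSymbol, quotientSymbol, hξ]
    · simp [hκ, cutoffSymbol, hξ]
  have hκF : ∀ N ω, occupationFourier Y 0 t (κ N) ω = ((1 / h : ℝ) : ℂ) *
      (occupationFourier Y 0 t (cutoffSymbol ℓ N (x + h)) ω -
        occupationFourier Y 0 t (cutoffSymbol ℓ N x) ω) +
      occupationFourier Y 0 t (cutoffSymbol (ℓ + 1) N x) ω := by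
    intro N ω
    rw [hκ]
    simp only
    rw [occupationFourier_add hY.measurable 0 t
      (((hc ℓ N (x + h)).sub (hc ℓ N x)).const_mul _) (hc (ℓ + 1) N x),
      occupationFourier_const_mul, occupationFourier_sub hY.measurable 0 t (hc _ _ _) (hc _ _ _)]
  set a : ℝ → ℝ → Ω → ℂ := fun N y ω =>
    occupationFourier Y 0 t (cutoffSymbol ℓ N y) ω - (Z₀ y ω : ℂ) with ha
  set b : ℝ → Ω → ℂ := fun N ω =>
    occupationFourier Y 0 t (cutoffSymbol (ℓ + 1) N x) ω - (Z₁ ω : ℂ) with hb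
  have ham : ∀ N y, AEStronglyMeasurable (a N y) P := fun N y =>
    ((hFm ℓ N y).sub (h₀ y).2.1).aestronglyMeasurable
  have hbm : ∀ N, AEStronglyMeasurable (b N) P := fun N =>
    ((hFm (ℓ + 1) N x).sub h₁.2.1).aestronglyMeasurable
  set c : ℂ := ((1 / h : ℝ) : ℂ) with hcdef
  have hlim : Tendsto (fun N => (‖c‖ₑ * (eLpNorm (a N (x + h)) 2 P + eLpNorm (a N x) 2 P) +
      eLpNorm (b N) 2 P) +
        momentIntegral H 2 0 t (fun ξ => ‖quotientSymbol ℓ x h ξ‖ₑ) ^ (1 / 2 : ℝ))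
      atTop (𝓝 ((‖c‖ₑ * (0 + 0) + 0) +
        momentIntegral H 2 0 t (fun ξ => ‖quotientSymbol ℓ x h ξ‖ₑ) ^ (1 / 2 : ℝ))) := by
    refine Tendsto.add_const _ (Tendsto.add (ENNReal.Tendsto.const_mul (Tendsto.add ?_ ?_)
      (Or.inr enorm_ne_top)) ?_)
    · exact tendsto_eLpNorm_occupationFourier_cutoff hY (h₀ (x + h))
    · exact tendsto_eLpNorm_occupationFourier_cutoff hY (h₀ x)
    · exact tendsto_eLpNorm_occupationFourier_cutoff hY h₁
  rw [add_zero, add_zero, mul_zero, zero_add] at hlim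
  refine ge_of_tendsto' hlim fun N => ?_
  have e : ∀ ω, ‖1 / h * (Z₀ (x + h) ω - Z₀ x ω) - -Z₁ ω‖ =
      ‖(occupationFourier Y 0 t (κ N) - ((c • (a N (x + h) - a N x)) + b N)) ω‖ := by
    intro ω
    rw [← Complex.norm_real]
    congr 1
    simp only [Pi.sub_apply, Pi.add_apply, Pi.smul_apply, smul_eq_mul, hκF, ha, hb, hcdef]
    push_cast
    ring
  rw [eLpNorm_congr_norm_ae (ae_of_all _ e), add_comm (_ + eLpNorm (b N) 2 P)]
  have hdm : AEStronglyMeasurable (c • (a N (x + h) - a N x)) P :=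
    ((ham N _).sub (ham N _)).const_smul c
  refine (eLpNorm_sub_le (memLp_occupationFourier (P := P) hY.measurable 0 t
    (hκh N).measurable 2).aestronglyMeasurable (hdm.add (hbm N)) one_le_two).trans ?_
  refine add_le_add ?_ ?_
  · refine (eLpNorm_two_occupationFourier_le hX hY le_rfl (hκh N)).trans ?_
    exact ENNReal.rpow_le_rpow (momentIntegral_mono H 2 0 t fun ξ =>
      enorm_le_iff_norm_le.2 (hκle N ξ)) (by norm_num)
  · refine (eLpNorm_add_le hdm (hbm N) one_le_two).trans (add_le_add_left ?_ _)
    rw [eLpNorm_const_smul]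
    exact mul_le_mul_right (eLpNorm_sub_le (ham N _) (ham N _) one_le_two) _

/-- The derivative in space of the `ℓ`-th derivative of the local time is, up to the sign, the
derivative of order `ℓ + 1`. The majorant for dominated convergence is of order `ℓ + 1`, whence the
condition on `H`. -/
theorem tendstoInL2_difference_quotient (hX : IsFractionalBrownianMotion H X P)
    (hY : IsMeasurableVersion P X Y) (hH0 : 0 < H) {ℓ : ℕ}
    (hH : H * (2 * (ℓ + 1 : ℕ) + 1) < 1) (t : ℝ≥0) (x : ℝ)
    {Z₀ : ℝ → Ω → ℝ} {Z₁ : Ω → ℝ}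
    (h₀ : ∀ y, TendstoInL2 P (fun N : ℝ => localTimeDerivFourier X ℓ N t y) atTop
      (fun ω => (Z₀ y ω : ℂ)))
    (h₁ : TendstoInL2 P (fun N : ℝ => localTimeDerivFourier X (ℓ + 1) N t x) atTop
      (fun ω => (Z₁ ω : ℂ))) :
    TendstoInL2 P (fun (h : ℝ) (ω : Ω) => 1 / h * (Z₀ (x + h) ω - Z₀ x ω)) (𝓝[≠] 0)
      (fun ω => -Z₁ ω) := by
  have hZ₀ : ∀ y, MemLp (Z₀ y) 2 P := fun y => memLp_of_memLp_ofReal (h₀ y).2.1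
  have hZ₁ : MemLp Z₁ 2 P := memLp_of_memLp_ofReal h₁.2.1
  refine ⟨Eventually.of_forall fun h => ((hZ₀ _).sub (hZ₀ _)).const_mul _, hZ₁.neg, ?_⟩
  have hE : momentIntegral H 2 0 t (fun ξ => 2 * ‖derivSymbol (ℓ + 1) x ξ‖ₑ) ≠ ⊤ := by
    rw [momentIntegral_const_mul _ _ _ _ ENNReal.ofNat_ne_top]
    exact ENNReal.mul_ne_top (ENNReal.pow_ne_top ENNReal.ofNat_ne_top)
      (momentIntegral_derivSymbol_ne_top hH0 hH two_ne_zero le_rfl (NNReal.coe_nonneg t) x)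
  have h2 := tendsto_momentIntegral (l := 𝓝[≠] 0) H 2 0 t hE
    (k := fun h => quotientSymbol ℓ x h) (k' := fun _ => 0)
    (Eventually.of_forall fun h => measurable_quotientSymbol ℓ x h)
    (Eventually.of_forall fun h ξ => by
      have := norm_quotientSymbol_le ℓ x h ξ
      rw [← ofReal_norm, ← ofReal_norm, ← ENNReal.ofReal_ofNat, ← ENNReal.ofReal_mul (by norm_num)]
      exact ENNReal.ofReal_le_ofReal this)
    (tendsto_quotientSymbol ℓ x)
  simp only [enorm_zero, momentIntegral_zero H two_ne_zero] at h2
  have h3 := ((ENNReal.continuous_rpow_const (y := 1 / 2)).tendsto 0).comp h2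
  rw [ENNReal.zero_rpow_of_pos (by norm_num)] at h3
  exact tendsto_of_tendsto_of_tendsto_of_le_of_le tendsto_const_nhds h3 (fun _ => zero_le)
    fun h => eLpNorm_difference_quotient_le hX hY t x h h₀ h₁

/-- Moments of even order of increments in time. Convergence in `L²` gives an almost surely
convergent subsequence of the truncated variables, and Fatou's lemma carries their bound over. -/
lemma eLpNorm_increment_le (hX : IsFractionalBrownianMotion H X P)
    (hY : IsMeasurableVersion P X Y) {ℓ : ℕ} (x : ℝ) {u v : ℝ≥0} (huv : u ≤ v) {Zu Zv : Ω → ℝ}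
    (hu : TendstoInL2 P (fun N : ℝ => localTimeDerivFourier X ℓ N u x) atTop
      (fun ω => (Zu ω : ℂ)))
    (hv : TendstoInL2 P (fun N : ℝ => localTimeDerivFourier X ℓ N v x) atTop
      (fun ω => (Zv ω : ℂ))) {n : ℕ} (hn : n ≠ 0) :
    eLpNorm (fun ω => Zv ω - Zu ω) ((2 * n : ℕ) : ℝ≥0∞) P ≤
      momentIntegral H (2 * n) u v (fun ξ => ‖derivSymbol ℓ x ξ‖ₑ) ^ (1 / ((2 * n : ℕ) : ℝ)) := by
  have hc := fun N : ℝ => isHermitianMultiplier_cutoffSymbol ℓ N x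
  have hFm := fun (a b N : ℝ) =>
    memLp_occupationFourier (P := P) hY.measurable a b (hc N).measurable 2
  have hlim : Tendsto (fun N : ℕ => eLpNorm (occupationFourier Y u v (cutoffSymbol ℓ N x) -
      fun ω => ((Zv ω - Zu ω : ℝ) : ℂ)) 2 P) atTop (𝓝 0) := by
    have h1 := ((tendsto_eLpNorm_occupationFourier_cutoff hY hv).add
      (tendsto_eLpNorm_occupationFourier_cutoff hY hu)).comp (tendsto_natCast_atTop_atTop (R := ℝ))
    rw [add_zero] at h1
    refine tendsto_of_tendsto_of_tendsto_of_le_of_le tendsto_const_nhds h1 (fun _ => zero_le)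
      fun N => ?_
    refine le_trans (le_of_eq ?_) (eLpNorm_sub_le ((hFm 0 v N).sub hv.2.1).aestronglyMeasurable
      ((hFm 0 u N).sub hu.2.1).aestronglyMeasurable one_le_two)
    congr 1
    ext ω
    simp only [Pi.sub_apply]
    rw [← occupationFourier_interval_sub hY.measurable (NNReal.coe_nonneg u)
      (NNReal.coe_le_coe.2 huv) (hc N)]
    push_cast
    ring
  have hZm : AEStronglyMeasurable (fun ω => ((Zv ω - Zu ω : ℝ) : ℂ)) P :=
    ((memLp_of_memLp_ofReal hv.2.1).sub (memLp_of_memLp_ofReal hu.2.1)).ofReal.aestronglyMeasurable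
  obtain ⟨ns, -, hns⟩ := (tendstoInMeasure_of_tendsto_eLpNorm two_ne_zero
    (fun N : ℕ => (hFm u v N).aestronglyMeasurable) hZm hlim).exists_seq_tendsto_ae
  have h1 := Lp.eLpNorm_lim_le_liminf_eLpNorm (p := ((2 * n : ℕ) : ℝ≥0∞))
    (fun i => (hFm u v (ns i)).aestronglyMeasurable) _ hns
  have h2 : eLpNorm (fun ω => Zv ω - Zu ω) ((2 * n : ℕ) : ℝ≥0∞) P =
      eLpNorm (fun ω => ((Zv ω - Zu ω : ℝ) : ℂ)) ((2 * n : ℕ) : ℝ≥0∞) P :=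
    eLpNorm_congr_norm_ae (ae_of_all _ fun ω => (Complex.norm_real _).symm)
  rw [h2]
  refine h1.trans ((liminf_le_liminf (Eventually.of_forall fun i =>
    (eLpNorm_occupationFourier_le hX hY (NNReal.coe_nonneg u) (hc (ns i)) hn).trans
      (ENNReal.rpow_le_rpow (momentIntegral_mono H (2 * n) u v fun ξ => enorm_le_iff_norm_le.2
        (norm_cutoffSymbol_le ℓ (ns i) x ξ)) (by positivity)))).trans ?_)
  exact (liminf_const _).le

/-- Moments of real order `2p`, by monotonicity of the norms from an even integer `2n ≥ 2p`. The
bound scales correctly because the `2n`-th moment integral is a pure power of `v - u`. -/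
theorem exists_eLpNorm_increment_rpow_le (hX : IsFractionalBrownianMotion H X P)
    (hY : IsMeasurableVersion P X Y) (hH0 : 0 < H) {ℓ : ℕ} (hH : H * (2 * ℓ + 1) < 1) (x : ℝ)
    {Z : ℝ≥0 → Ω → ℝ}
    (hZ : ∀ t, TendstoInL2 P (fun N : ℝ => localTimeDerivFourier X ℓ N t x) atTop
      (fun ω => (Z t ω : ℂ))) {p : ℝ} (hp : 1 < p) :
    ∃ C : ℝ, ∀ u v : ℝ≥0, u < v →
      eLpNorm (fun ω => Z v ω - Z u ω) (ENNReal.ofReal (2 * p)) P ^ (2 * p) ≤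
        ENNReal.ofReal (C * |(u : ℝ) - (v : ℝ)| ^ (2 * p * (1 - H * ((ℓ : ℝ) + 1)))) := by
  obtain ⟨n, hn⟩ := exists_nat_ge p
  have hn0 : n ≠ 0 := by
    rintro rfl
    norm_num at hn
    linarith
  obtain ⟨C, hC⟩ := exists_momentIntegral_le hH0 hH (2 * n)
  set A : ℝ := (1 / (2 * Real.pi)) ^ (2 * n) * C with hA
  have hA0 : 0 ≤ A := by positivity
  refine ⟨A ^ (p / n), fun u v huv => ?_⟩
  have hd : (0 : ℝ) < (v : ℝ) - u := sub_pos.2 huv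
  have hM : momentIntegral H (2 * n) u v (fun ξ => ‖derivSymbol ℓ x ξ‖ₑ) ≤
      ENNReal.ofReal (A * ((v : ℝ) - u) ^ ((2 * n : ℕ) * (1 - H * (ℓ + 1)))) := by
    simp_rw [enorm_derivSymbol]
    rw [momentIntegral_const_mul _ _ _ _ ENNReal.ofReal_ne_top, hA, mul_assoc,
      ENNReal.ofReal_mul (by positivity), ENNReal.ofReal_pow (by positivity),
      ENNReal.ofReal_mul (NNReal.coe_nonneg C), ENNReal.ofReal_coe_nnreal]
    exact mul_le_mul_right (hC u v (NNReal.coe_nonneg u) (NNReal.coe_lt_coe.2 huv)) _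
  have hZm : AEStronglyMeasurable (fun ω => Z v ω - Z u ω) P :=
    ((memLp_of_memLp_ofReal (hZ v).2.1).sub (memLp_of_memLp_ofReal (hZ u).2.1)).aestronglyMeasurable
  have hpn : ENNReal.ofReal (2 * p) ≤ ((2 * n : ℕ) : ℝ≥0∞) := by
    rw [← ENNReal.ofReal_natCast]
    refine ENNReal.ofReal_le_ofReal ?_
    push_cast
    linarith
  have hpos : (0 : ℝ) < n := by exact_mod_cast Nat.pos_of_ne_zero hn0
  calc eLpNorm (fun ω => Z v ω - Z u ω) (ENNReal.ofReal (2 * p)) P ^ (2 * p) ≤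
        (ENNReal.ofReal (A * ((v : ℝ) - u) ^ ((2 * n : ℕ) * (1 - H * (ℓ + 1)))) ^
          (1 / ((2 * n : ℕ) : ℝ))) ^ (2 * p) := by
        refine ENNReal.rpow_le_rpow ?_ (by linarith)
        exact (eLpNorm_le_eLpNorm_of_exponent_le hpn hZm).trans
          ((eLpNorm_increment_le hX hY x huv.le (hZ u) (hZ v) hn0).trans
            (ENNReal.rpow_le_rpow hM (by positivity)))
    _ = _ := by
        have e1 : 1 / ((2 * n : ℕ) : ℝ) * (2 * p) = p / n := by
          push_cast
          field_simp
        rw [← ENNReal.rpow_mul, e1, ENNReal.ofReal_rpow_of_nonneg (by positivity) (by positivity),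
          Real.mul_rpow hA0 (by positivity), ← Real.rpow_mul hd.le, abs_sub_comm,
          abs_of_pos hd]
        congr 3
        push_cast
        field_simp

end Increments

/-! ### Kolmogorov continuity -/

/-- The dyadic approximation `⌊2^n t⌋ / 2^n` of `t` from below. -/
noncomputable def dyadicFloor (n : ℕ) (t : ℝ≥0) : ℝ≥0 := (⌊2 ^ n * t⌋₊ : ℝ≥0) / 2 ^ n

lemma dyadicFloor_le (n : ℕ) (t : ℝ≥0) : dyadicFloor n t ≤ t := by
  rw [dyadicFloor, div_le_iff₀ (by positivity), mul_comm]
  exact Nat.floor_le zero_le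

lemma le_dyadicFloor_add (n : ℕ) (t : ℝ≥0) : (t : ℝ) - dyadicFloor n t ≤ (1 / 2) ^ n := by
  have h := (Nat.lt_floor_add_one (2 ^ n * t)).le
  have h' : (2 : ℝ) ^ n * t ≤ ⌊2 ^ n * t⌋₊ + 1 := by exact_mod_cast h
  have h2 : ((dyadicFloor n t : ℝ≥0) : ℝ) = ⌊2 ^ n * t⌋₊ / 2 ^ n := by
    rw [dyadicFloor]; push_cast; rfl
  have h3 : (0 : ℝ) < 2 ^ n := by positivity
  rw [h2, one_div, inv_pow, sub_le_iff_le_add, ← one_div, ← add_div, le_div_iff₀ h3]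
  linarith

/-- Consecutive or equal points of level `n`. The condition `a < 4 ^ n` means that the left point is
below `2 ^ n`, so that every bounded interval is eventually covered as `n` grows. -/
lemma abs_sub_dyadic_le {f : ℝ≥0 → ℝ} {ρ : ℝ} (hρ : 0 ≤ ρ) {n : ℕ}
    (hf : ∀ k < 4 ^ n, |f ((k + 1 : ℕ) / 2 ^ n) - f ((k : ℕ) / 2 ^ n)| ≤ ρ ^ n) {a b : ℕ}
    (ha : a < 4 ^ n) (h1 : a ≤ b) (h2 : b ≤ a + 1) :
    |f ((b : ℝ≥0) / 2 ^ n) - f ((a : ℝ≥0) / 2 ^ n)| ≤ ρ ^ n := by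
  rcases Nat.le_add_one_iff.1 h2 with h | h
  · rw [le_antisymm h h1, sub_self, abs_zero]; positivity
  · rw [h]; exact hf a ha

lemma floor_lt_four_pow {n : ℕ} {t T : ℝ≥0} (ht : t ≤ T) (hT : T < 2 ^ n) :
    ⌊2 ^ n * t⌋₊ < 4 ^ n := by
  rw [Nat.floor_lt zero_le]
  have : (4 : ℝ≥0) ^ n = 2 ^ n * 2 ^ n := by rw [← mul_pow]; norm_num
  push_cast
  rw [this]
  have h0 : (0 : ℝ≥0) < 2 ^ n := by positivity
  exact mul_lt_mul_of_pos_left (ht.trans_lt hT) h0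

lemma abs_dyadicFloor_succ_sub_le {f : ℝ≥0 → ℝ} {ρ : ℝ} (hρ : 0 ≤ ρ) {n : ℕ}
    (hf : ∀ k < 4 ^ (n + 1), |f ((k + 1 : ℕ) / 2 ^ (n + 1)) - f ((k : ℕ) / 2 ^ (n + 1))| ≤
      ρ ^ (n + 1)) {t T : ℝ≥0} (ht : t ≤ T) (hT : T < 2 ^ n) :
    |f (dyadicFloor (n + 1) t) - f (dyadicFloor n t)| ≤ ρ ^ (n + 1) := by
  set a := ⌊2 ^ n * t⌋₊ with ha
  have e : dyadicFloor n t = ((2 * a : ℕ) : ℝ≥0) / 2 ^ (n + 1) := by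
    rw [dyadicFloor, ← ha, pow_succ]
    push_cast
    rw [mul_comm (2 : ℝ≥0) a, mul_div_mul_right _ _ two_ne_zero]
  have hle : 2 * a ≤ ⌊2 ^ (n + 1) * t⌋₊ := by
    refine Nat.le_floor ?_
    push_cast
    rw [pow_succ', mul_assoc]
    gcongr
    exact Nat.floor_le zero_le
  have hlt : ⌊2 ^ (n + 1) * t⌋₊ < 2 * a + 2 := by
    rw [Nat.floor_lt zero_le]
    push_cast
    rw [pow_succ', mul_assoc]
    have := Nat.lt_floor_add_one (2 ^ n * t)
    calc 2 * (2 ^ n * t) < 2 * ((a : ℝ≥0) + 1) := by gcongr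
      _ = _ := by ring
  have h4 : ⌊2 ^ (n + 1) * t⌋₊ < 4 ^ (n + 1) := floor_lt_four_pow ht (hT.trans_le (by
    gcongr
    · norm_num
    · omega))
  rw [e]
  exact abs_sub_dyadic_le hρ hf (hle.trans_lt h4) hle (by omega)

/-- If the increments over the dyadic intervals of level `n` are at most `ρ ^ n`, the values at the
dyadic approximations of `t` converge geometrically. -/
lemma exists_tendsto_dyadicFloor {f : ℝ≥0 → ℝ} {ρ : ℝ} (hρ : 0 ≤ ρ) (hρ1 : ρ < 1) {n₀ : ℕ}
    (hf : ∀ n ≥ n₀, ∀ k < 4 ^ n, |f ((k + 1 : ℕ) / 2 ^ n) - f ((k : ℕ) / 2 ^ n)| ≤ ρ ^ n)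
    {t T : ℝ≥0} (ht : t ≤ T) (hT : T < 2 ^ n₀) :
    ∃ y, Tendsto (fun n => f (dyadicFloor n t)) atTop (𝓝 y) ∧
      ∀ n ≥ n₀, |f (dyadicFloor n t) - y| ≤ ρ ^ n / (1 - ρ) := by
  have hstep : ∀ m, dist (f (dyadicFloor (m + n₀) t)) (f (dyadicFloor (m + 1 + n₀) t)) ≤
      ρ ^ n₀ * ρ ^ m := by
    intro m
    rw [dist_comm, Real.dist_eq, show m + 1 + n₀ = (m + n₀) + 1 by ring]
    refine (abs_dyadicFloor_succ_sub_le hρ (hf _ (by omega)) ht (hT.trans_le ?_)).trans ?_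
    · gcongr
      · norm_num
      · omega
    · rw [← pow_add]
      exact pow_le_pow_of_le_one hρ hρ1.le (by omega)
  obtain ⟨y, hy⟩ := cauchySeq_tendsto_of_complete (cauchySeq_of_le_geometric ρ _ hρ1 hstep)
  refine ⟨y, (tendsto_add_atTop_iff_nat n₀).1 hy, fun n hn => ?_⟩
  have := dist_le_of_le_geometric_of_tendsto ρ _ hρ1 hstep hy (n - n₀)
  rwa [Nat.sub_add_cancel hn, Real.dist_eq, ← pow_add, Nat.add_sub_cancel' hn] at this

/-- Deterministic part of the Kolmogorov continuity theorem. Points at distance about `2⁻ⁿ` are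
compared through their dyadic approximations of level `n`; points at distance more than `2 ^ (-n₀)`
through the bound `M` for the path on `[0, T]`. -/
lemma isLocallyHolder_of_dyadic {f g : ℝ≥0 → ℝ} {γ : ℝ≥0} (hγ : 0 < γ)
    (hf : ∀ᶠ n : ℕ in atTop, ∀ k < 4 ^ n,
      |f ((k + 1 : ℕ) / 2 ^ n) - f ((k : ℕ) / 2 ^ n)| ≤ ((1 / 2 : ℝ) ^ (γ : ℝ)) ^ n)
    (hg : ∀ t, Tendsto (fun n => f (dyadicFloor n t)) atTop (𝓝 (g t))) : IsLocallyHolder γ g := by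
  intro T
  set ρ := (1 / 2 : ℝ) ^ (γ : ℝ) with hρdef
  have hγ' : (0 : ℝ) < γ := hγ
  have hρ : 0 < ρ := by positivity
  have hρ1 : ρ < 1 := Real.rpow_lt_one (by norm_num) (by norm_num) hγ'
  have hρ2 : 0 < 1 - ρ := sub_pos.2 hρ1
  obtain ⟨N, hN⟩ := eventually_atTop.1 hf
  obtain ⟨N', hN'⟩ := pow_unbounded_of_one_lt T (one_lt_two (α := ℝ≥0))
  set n₀ := max N N' with hn₀
  have hfn : ∀ n ≥ n₀, ∀ k < 4 ^ n, |f ((k + 1 : ℕ) / 2 ^ n) - f ((k : ℕ) / 2 ^ n)| ≤ ρ ^ n :=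
    fun n hn => hN n ((le_max_left _ _).trans hn)
  have hTn : ∀ n ≥ n₀, T < 2 ^ n := fun n hn => hN'.trans_le (by
    gcongr
    · norm_num
    · exact (le_max_right _ _).trans hn)
  have hclose : ∀ t ≤ T, ∀ n ≥ n₀, |f (dyadicFloor n t) - g t| ≤ ρ ^ n / (1 - ρ) := by
    intro t ht n hn
    obtain ⟨y, hy, hy'⟩ := exists_tendsto_dyadicFloor hρ.le hρ1 hfn ht (hTn n₀ le_rfl)
    rw [tendsto_nhds_unique (hg t) hy]
    exact hy' n hn
  set M := ∑ k ∈ Finset.range (4 ^ n₀), |f ((k : ℝ≥0) / 2 ^ n₀)| + ρ ^ n₀ / (1 - ρ) with hM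
  have hM0 : 0 ≤ M := add_nonneg (Finset.sum_nonneg fun _ _ => abs_nonneg _) (by positivity)
  have hgM : ∀ t ≤ T, |g t| ≤ M := by
    intro t ht
    have h1 : |f (dyadicFloor n₀ t)| ≤ ∑ k ∈ Finset.range (4 ^ n₀), |f ((k : ℝ≥0) / 2 ^ n₀)| :=
      Finset.single_le_sum (f := fun k : ℕ => |f ((k : ℝ≥0) / 2 ^ n₀)|) (fun _ _ => abs_nonneg _)
        (Finset.mem_range.2 (floor_lt_four_pow ht (hTn n₀ le_rfl)))
    have h2 := hclose t ht n₀ le_rfl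
    have h3 := abs_sub_abs_le_abs_sub (g t) (f (dyadicFloor n₀ t))
    rw [abs_sub_comm] at h3
    linarith
  set K : ℝ := (2 / (1 - ρ) + 1) / ρ + 2 * M / ρ ^ n₀ with hK
  have hK0 : 0 ≤ K := by positivity
  have key : ∀ s t : ℝ≥0, s < t → t ≤ T → |g t - g s| ≤ K * ((t : ℝ) - s) ^ (γ : ℝ) := by
    intro s t hst ht
    have hsT : s ≤ T := hst.le.trans ht
    have hx : (0 : ℝ) < (t : ℝ) - s := sub_pos.2 hst
    rw [hK, add_mul]
    have hpow : ∀ n : ℕ, ρ ^ n = ((1 / 2 : ℝ) ^ n) ^ (γ : ℝ) := fun n => by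
      rw [hρdef, ← Real.rpow_natCast, ← Real.rpow_natCast, ← Real.rpow_mul (by norm_num),
        ← Real.rpow_mul (by norm_num), mul_comm]
    by_cases hclosepts : (t : ℝ) - s ≤ (1 / 2) ^ n₀
    · obtain ⟨n, hn1, hn2⟩ := exists_nat_pow_near_of_lt_one hx
        (hclosepts.trans (pow_le_one₀ (by norm_num) (by norm_num)))
        (show (0 : ℝ) < 1 / 2 by norm_num) (by norm_num)
      have hn : n₀ ≤ n := by
        by_contra hlt
        have : (1 / 2 : ℝ) ^ n₀ ≤ (1 / 2) ^ (n + 1) :=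
          pow_le_pow_of_le_one (by norm_num) (by norm_num) (by omega)
        linarith
      have hfl : ⌊2 ^ n * t⌋₊ ≤ ⌊2 ^ n * s⌋₊ + 1 := by
        rw [← Nat.floor_add_one zero_le]
        refine Nat.floor_le_floor ?_
        rw [← NNReal.coe_le_coe]
        push_cast
        have h5 : (2 : ℝ) ^ n * (t - s) ≤ 2 ^ n * (1 / 2) ^ n :=
          mul_le_mul_of_nonneg_left hn2 (by positivity)
        rw [← mul_pow] at h5
        norm_num at h5
        linarith
      have h1 := abs_sub_dyadic_le hρ.le (hfn n hn) (floor_lt_four_pow hsT (hTn n hn))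
        (Nat.floor_le_floor (mul_le_mul_right hst.le (2 ^ n))) hfl
      have h2 := hclose t ht n hn
      have h3 := hclose s hsT n hn
      change |f (dyadicFloor n t) - f (dyadicFloor n s)| ≤ ρ ^ n at h1
      have h4 : |g t - g s| ≤ (2 / (1 - ρ) + 1) * ρ ^ n := by
        rw [abs_le] at h1 h2 h3 ⊢
        have : (2 / (1 - ρ) + 1) * ρ ^ n = ρ ^ n / (1 - ρ) + ρ ^ n / (1 - ρ) + ρ ^ n := by ring
        constructor <;> linarith
      have h5 : ρ ^ (n + 1) ≤ ((t : ℝ) - s) ^ (γ : ℝ) := by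
        rw [hpow]
        exact Real.rpow_le_rpow (by positivity) hn1.le hγ'.le
      calc |g t - g s| ≤ (2 / (1 - ρ) + 1) / ρ * ρ ^ (n + 1) := by
            rw [pow_succ]; field_simp; field_simp at h4; linarith
        _ ≤ (2 / (1 - ρ) + 1) / ρ * ((t : ℝ) - s) ^ (γ : ℝ) := by gcongr
        _ ≤ _ := le_add_of_nonneg_right (by positivity)
    · have h1 : ρ ^ n₀ ≤ ((t : ℝ) - s) ^ (γ : ℝ) := by
        rw [hpow]
        exact Real.rpow_le_rpow (by positivity) (not_le.1 hclosepts).le hγ'.le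
      calc |g t - g s| ≤ |g t| + |g s| := abs_sub _ _
        _ ≤ 2 * M := by linarith [hgM t ht, hgM s hsT]
        _ = 2 * M / ρ ^ n₀ * ρ ^ n₀ := by field_simp
        _ ≤ 2 * M / ρ ^ n₀ * ((t : ℝ) - s) ^ (γ : ℝ) := by gcongr
        _ ≤ _ := le_add_of_nonneg_left (by positivity)
  have hdist : ∀ s ∈ Set.Icc 0 T, ∀ t ∈ Set.Icc 0 T,
      dist (g s) (g t) ≤ K * dist s t ^ (γ : ℝ) := by
    intro s hs t ht
    rcases lt_trichotomy s t with h | rfl | h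
    · rw [dist_comm, Real.dist_eq, NNReal.dist_eq, abs_sub_comm (s : ℝ),
        abs_of_pos (sub_pos.2 (NNReal.coe_lt_coe.2 h))]
      exact key s t h ht.2
    · rw [dist_self, dist_self]; positivity
    · rw [Real.dist_eq, NNReal.dist_eq, abs_of_pos (sub_pos.2 (NNReal.coe_lt_coe.2 h))]
      exact key t s h hs.2
  refine ⟨K.toNNReal, fun s hs t ht => ?_⟩
  rw [edist_dist, edist_dist, ENNReal.ofReal_rpow_of_nonneg dist_nonneg (NNReal.coe_nonneg γ),
    ENNReal.ofNNReal_toNNReal, ← ENNReal.ofReal_mul hK0]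
  exact ENNReal.ofReal_le_ofReal (hdist s hs t ht)

section Kolmogorov
variable {Ω : Type*} [MeasurableSpace Ω] {P : Measure Ω}

/-- By Borel–Cantelli. The exponent `p` is chosen such that `2p(β - γ) ≥ 3`; then each of the
`4 ^ n` intervals of level `n` fails with probability at most `C * 8 ^ (-n)`, which is summable with
the number of intervals. -/
lemma ae_eventually_dyadic_increment_le {β : ℝ} {W : ℝ≥0 → Ω → ℝ} (hW : ∀ t, Measurable (W t))
    (hmom : ∀ p : ℝ, 1 < p → ∃ C : ℝ, ∀ u v : ℝ≥0, u < v →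
      eLpNorm (fun ω => W v ω - W u ω) (ENNReal.ofReal (2 * p)) P ^ (2 * p) ≤
        ENNReal.ofReal (C * |(u : ℝ) - (v : ℝ)| ^ (2 * p * β))) {γ : ℝ} (hγ : γ < β) :
    ∀ᵐ ω ∂P, ∀ᶠ n : ℕ in atTop, ∀ k < 4 ^ n,
      |W ((k + 1 : ℕ) / 2 ^ n) ω - W ((k : ℕ) / 2 ^ n) ω| ≤ ((1 / 2 : ℝ) ^ γ) ^ n := by
  have hβγ : 0 < β - γ := sub_pos.2 hγ
  set p : ℝ := 2 + 2 / (β - γ) with hp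
  have hp1 : 1 < p := by
    have : 0 < 2 / (β - γ) := by positivity
    linarith
  have hp3 : 3 ≤ 2 * p * (β - γ) := by
    have : 2 / (β - γ) * (β - γ) = 2 := by field_simp
    nlinarith
  obtain ⟨C, hC⟩ := hmom p hp1
  set ε : ℕ → ℝ := fun n => ((1 / 2 : ℝ) ^ γ) ^ n with hε
  have hε0 : ∀ n, 0 < ε n := fun n => by positivity
  set A : ℕ → ℕ → Set Ω := fun n k =>
    {ω | ENNReal.ofReal (ε n) ≤ ‖W ((k + 1 : ℕ) / 2 ^ n) ω - W ((k : ℕ) / 2 ^ n) ω‖ₑ} with hA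
  have hAk : ∀ n k, P (A n k) ≤ ENNReal.ofReal (|C| * (1 / 8) ^ n) := by
    intro n k
    have hlt : ((k : ℕ) / 2 ^ n : ℝ≥0) < (k + 1 : ℕ) / 2 ^ n := by
      gcongr
      exact k.lt_succ_self
    have h1 := meas_ge_le_mul_pow_eLpNorm_enorm P (p := ENNReal.ofReal (2 * p))
      (f := fun ω => W ((k + 1 : ℕ) / 2 ^ n) ω - W ((k : ℕ) / 2 ^ n) ω)
      (by simp; linarith) ENNReal.ofReal_ne_top
      ((hW _).sub (hW _)).aestronglyMeasurable (ε := ENNReal.ofReal (ε n))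
      (by simpa using hε0 n) (fun h => absurd h ENNReal.ofReal_ne_top)
    refine h1.trans ?_
    rw [ENNReal.toReal_ofReal (by linarith)]
    refine (mul_le_mul_right (hC _ _ hlt) _).trans ?_
    have hd : |(((k : ℕ) / 2 ^ n : ℝ≥0) : ℝ) - (((k + 1 : ℕ) / 2 ^ n : ℝ≥0) : ℝ)| =
        (1 / 2) ^ n := by
      push_cast
      rw [← sub_div, show (k : ℝ) - (k + 1) = -1 by ring, abs_div, abs_neg, abs_one, abs_pow,
        abs_two, one_div, one_div, inv_pow]
    rw [hd, ← ENNReal.ofReal_inv_of_pos (hε0 n),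
      ENNReal.ofReal_rpow_of_nonneg (by positivity) (by linarith),
      ← ENNReal.ofReal_mul (by positivity)]
    refine ENNReal.ofReal_le_ofReal ?_
    have e1 : (ε n)⁻¹ ^ (2 * p) = ((1 / 2 : ℝ) ^ n) ^ (-(2 * p * γ)) := by
      rw [hε]
      simp only
      rw [← Real.rpow_natCast, ← Real.rpow_natCast, ← Real.rpow_mul (by norm_num),
        ← Real.rpow_neg (by norm_num), ← Real.rpow_mul (by norm_num),
        ← Real.rpow_mul (by norm_num)]
      congr 1
      ring
    rw [e1, mul_left_comm, ← Real.rpow_add (by positivity)]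
    have e2 : ((1 / 2 : ℝ) ^ n) ^ (-(2 * p * γ) + 2 * p * β) ≤ (1 / 8) ^ n := by
      calc ((1 / 2 : ℝ) ^ n) ^ (-(2 * p * γ) + 2 * p * β) ≤ ((1 / 2 : ℝ) ^ n) ^ ((3 : ℕ) : ℝ) := by
            refine Real.rpow_le_rpow_of_exponent_ge (by positivity)
              (pow_le_one₀ (by norm_num) (by norm_num)) ?_
            push_cast
            linarith
        _ = (1 / 8) ^ n := by
            rw [Real.rpow_natCast, ← pow_mul, mul_comm, pow_mul]
            norm_num
    calc C * ((1 / 2 : ℝ) ^ n) ^ (-(2 * p * γ) + 2 * p * β) ≤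
          |C| * ((1 / 2 : ℝ) ^ n) ^ (-(2 * p * γ) + 2 * p * β) := by
            gcongr; exact le_abs_self C
      _ ≤ _ := by gcongr
  have hsum : ∀ n, P (⋃ k ∈ Finset.range (4 ^ n), A n k) ≤ ENNReal.ofReal (|C| * (1 / 2) ^ n) := by
    intro n
    refine (measure_biUnion_finset_le _ _).trans ((Finset.sum_le_sum fun k _ => hAk n k).trans ?_)
    rw [Finset.sum_const, Finset.card_range, nsmul_eq_mul, ← ENNReal.ofReal_natCast,
      ← ENNReal.ofReal_mul (by positivity)]
    refine ENNReal.ofReal_le_ofReal (le_of_eq ?_)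
    push_cast
    rw [mul_left_comm, ← mul_pow]
    norm_num
  have hfin : ∑' n, P (⋃ k ∈ Finset.range (4 ^ n), A n k) ≠ ⊤ := by
    refine ne_top_of_le_ne_top ?_ (ENNReal.tsum_le_tsum hsum)
    rw [← ENNReal.ofReal_tsum_of_nonneg (fun n => by positivity)
      ((summable_geometric_of_lt_one (by norm_num) (by norm_num)).mul_left _)]
    exact ENNReal.ofReal_ne_top
  filter_upwards [ae_eventually_notMem hfin] with ω hω
  filter_upwards [hω] with n hn k hk
  have h1 : ω ∉ A n k := fun h => hn (Set.mem_biUnion (Finset.mem_coe.2 (Finset.mem_range.2 hk)) h)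
  have h2 : ‖W ((k + 1 : ℕ) / 2 ^ n) ω - W ((k : ℕ) / 2 ^ n) ω‖ₑ < ENNReal.ofReal (ε n) :=
    not_le.1 h1
  rw [← ofReal_norm, ENNReal.ofReal_lt_ofReal_iff (hε0 n), Real.norm_eq_abs] at h2
  exact h2.le

lemma tendstoInMeasure_dyadicFloor {β : ℝ} (hβ : 0 < β) {W : ℝ≥0 → Ω → ℝ}
    (hW : ∀ t, Measurable (W t))
    (hmom : ∀ p : ℝ, 1 < p → ∃ C : ℝ, ∀ u v : ℝ≥0, u < v →
      eLpNorm (fun ω => W v ω - W u ω) (ENNReal.ofReal (2 * p)) P ^ (2 * p) ≤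
        ENNReal.ofReal (C * |(u : ℝ) - (v : ℝ)| ^ (2 * p * β))) (t : ℝ≥0) :
    TendstoInMeasure P (fun n => W (dyadicFloor n t)) atTop (W t) := by
  obtain ⟨C, hC⟩ := hmom 2 one_lt_two
  refine tendstoInMeasure_of_tendsto_eLpNorm (p := ENNReal.ofReal (2 * 2)) (by simp)
    (fun n => (hW _).aestronglyMeasurable) (hW t).aestronglyMeasurable ?_
  have hle : ∀ n, eLpNorm (W (dyadicFloor n t) - W t) (ENNReal.ofReal (2 * 2)) P ≤
      ENNReal.ofReal (|C| * ((1 / 2 : ℝ) ^ (2 * 2 * β)) ^ n) ^ (2 * 2 : ℝ)⁻¹ := by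
    intro n
    rw [ENNReal.le_rpow_inv_iff (by norm_num), eLpNorm_sub_comm]
    rcases (dyadicFloor_le n t).eq_or_lt with h | h
    · rw [h, sub_self, eLpNorm_zero, ENNReal.zero_rpow_of_pos (by norm_num)]
      exact zero_le
    · refine (hC _ _ h).trans (ENNReal.ofReal_le_ofReal ?_)
      have e : ((1 / 2 : ℝ) ^ (2 * 2 * β)) ^ n = ((1 / 2 : ℝ) ^ n) ^ (2 * 2 * β) := by
        rw [← Real.rpow_natCast, ← Real.rpow_natCast, ← Real.rpow_mul (by norm_num),
          ← Real.rpow_mul (by norm_num), mul_comm]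
      rw [e, abs_sub_comm, abs_of_pos (sub_pos.2 (NNReal.coe_lt_coe.2 h))]
      have h0 : (0 : ℝ) ≤ t - dyadicFloor n t := (sub_pos.2 (NNReal.coe_lt_coe.2 h)).le
      calc C * ((t : ℝ) - dyadicFloor n t) ^ (2 * 2 * β) ≤
            |C| * ((t : ℝ) - dyadicFloor n t) ^ (2 * 2 * β) := by gcongr; exact le_abs_self C
        _ ≤ _ := by gcongr; exact le_dyadicFloor_add n t
  have hlim : Tendsto (fun n : ℕ => ENNReal.ofReal (|C| * ((1 / 2 : ℝ) ^ (2 * 2 * β)) ^ n) ^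
      (2 * 2 : ℝ)⁻¹) atTop (𝓝 0) := by
    have h1 : Tendsto (fun n : ℕ => |C| * ((1 / 2 : ℝ) ^ (2 * 2 * β)) ^ n) atTop (𝓝 (|C| * 0)) :=
      (tendsto_pow_atTop_nhds_zero_of_lt_one (by positivity)
        (Real.rpow_lt_one (by norm_num) (by norm_num) (by positivity))).const_mul _
    have h2 := (ENNReal.tendsto_ofReal h1)
    have h3 := ((ENNReal.continuous_rpow_const (y := (2 * 2)⁻¹)).tendsto _).comp h2
    rw [mul_zero, ENNReal.ofReal_zero, ENNReal.zero_rpow_of_pos (by norm_num)] at h3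
    exact h3
  exact tendsto_of_tendsto_of_tendsto_of_le_of_le tendsto_const_nhds hlim (fun _ => zero_le) hle

/-- A version of the Kolmogorov continuity theorem with moments of all orders. The modification is
the limit of the values at the dyadic approximations on the event where all dyadic estimates hold,
and `0` elsewhere. -/
theorem exists_holder_modification {β : ℝ} (hβ : 0 < β) {W : ℝ≥0 → Ω → ℝ}
    (hW : ∀ t, AEMeasurable (W t) P)
    (hmom : ∀ p : ℝ, 1 < p → ∃ C : ℝ, ∀ u v : ℝ≥0, u < v →
      eLpNorm (fun ω => W v ω - W u ω) (ENNReal.ofReal (2 * p)) P ^ (2 * p) ≤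
        ENNReal.ofReal (C * |(u : ℝ) - (v : ℝ)| ^ (2 * p * β))) :
    ∃ Z : ℝ≥0 → Ω → ℝ, IsModificationOf P Z W ∧
      ∀ γ : ℝ≥0, 0 < γ → (γ : ℝ) < β → ∀ ω, IsLocallyHolder γ (fun t => Z t ω) := by
  set V : ℝ≥0 → Ω → ℝ := fun t => (hW t).mk (W t) with hV
  have hVm : ∀ t, Measurable (V t) := fun t => (hW t).measurable_mk
  have hVmom : ∀ p : ℝ, 1 < p → ∃ C : ℝ, ∀ u v : ℝ≥0, u < v →
      eLpNorm (fun ω => V v ω - V u ω) (ENNReal.ofReal (2 * p)) P ^ (2 * p) ≤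
        ENNReal.ofReal (C * |(u : ℝ) - (v : ℝ)| ^ (2 * p * β)) := by
    intro p hp
    obtain ⟨C, hC⟩ := hmom p hp
    refine ⟨C, fun u v huv => (hC u v huv).trans' (le_of_eq ?_)⟩
    congr 1
    refine eLpNorm_congr_ae ?_
    filter_upwards [(hW u).ae_eq_mk, (hW v).ae_eq_mk] with ω h1 h2
    rw [h1, h2]
  -- one null set serves all exponents, as the estimates for rational exponents imply the others
  have hgood : ∀ᵐ ω ∂P, ∀ γ : ℝ, 0 < γ → γ < β → ∀ᶠ n : ℕ in atTop, ∀ k < 4 ^ n,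
      |V ((k + 1 : ℕ) / 2 ^ n) ω - V ((k : ℕ) / 2 ^ n) ω| ≤ ((1 / 2 : ℝ) ^ γ) ^ n := by
    have h1 : ∀ᵐ ω ∂P, ∀ r : ℚ, (r : ℝ) < β → ∀ᶠ n : ℕ in atTop, ∀ k < 4 ^ n,
        |V ((k + 1 : ℕ) / 2 ^ n) ω - V ((k : ℕ) / 2 ^ n) ω| ≤ ((1 / 2 : ℝ) ^ (r : ℝ)) ^ n := by
      refine ae_all_iff.2 fun r => ?_
      by_cases hr : (r : ℝ) < β
      · filter_upwards [ae_eventually_dyadic_increment_le hVm hVmom hr] with ω hω _ using hω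
      · exact ae_of_all _ fun ω h => absurd h hr
    filter_upwards [h1] with ω hω γ _ hγ
    obtain ⟨r, hr1, hr2⟩ := exists_rat_btwn hγ
    filter_upwards [hω r hr2] with n hn k hk
    refine (hn k hk).trans (pow_le_pow_left₀ (by positivity) ?_ n)
    exact Real.rpow_le_rpow_of_exponent_ge (by norm_num) (by norm_num) hr1.le
  obtain ⟨G, hGae, hGm, hG⟩ := hgood.exists_measurable_mem
  have hlim : ∀ ω ∈ G, ∀ t, ∃ y, Tendsto (fun n => V (dyadicFloor n t) ω) atTop (𝓝 y) := by
    intro ω hω t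
    obtain ⟨N, hN⟩ := eventually_atTop.1 (hG ω hω (β / 2) (by positivity) (by linarith))
    obtain ⟨N', hN'⟩ := pow_unbounded_of_one_lt t (one_lt_two (α := ℝ≥0))
    obtain ⟨y, hy, _⟩ := exists_tendsto_dyadicFloor (f := fun s => V s ω) (n₀ := max N N')
      (by positivity)
      (Real.rpow_lt_one (by norm_num) (by norm_num) (by positivity : 0 < β / 2))
      (fun n hn => hN n ((le_max_left _ _).trans hn)) (le_refl t)
      (hN'.trans_le (by
        gcongr
        · norm_num
        · exact le_max_right _ _))
    exact ⟨y, hy⟩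
  choose! g hg using hlim
  set Z : ℝ≥0 → Ω → ℝ := fun t => G.indicator fun ω => g ω t with hZ
  have hZlim : ∀ t ω, Tendsto (fun n => G.indicator (V (dyadicFloor n t)) ω) atTop
      (𝓝 (Z t ω)) := by
    intro t ω
    by_cases hω : ω ∈ G
    · simp only [hZ, Set.indicator_of_mem hω]
      exact hg ω hω t
    · simp only [hZ, Set.indicator_of_notMem hω]
      exact tendsto_const_nhds
  refine ⟨Z, fun t => ⟨?_, ?_⟩, fun γ hγ0 hγ ω => ?_⟩
  · exact measurable_of_tendsto_metrizable (fun n => (hVm (dyadicFloor n t)).indicator hGm)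
      (tendsto_pi_nhds.2 fun ω => hZlim t ω)
  · obtain ⟨ns, hns, hae⟩ := (tendstoInMeasure_dyadicFloor hβ hVm hVmom t).exists_seq_tendsto_ae
    filter_upwards [hae, hGae, (hW t).ae_eq_mk] with ω h1 h2 h3
    have h4 := (hg ω h2 t).comp hns.tendsto_atTop
    rw [h3, hZ]
    simp only [Set.indicator_of_mem h2]
    exact tendsto_nhds_unique h4 h1
  · by_cases hω : ω ∈ G
    · have := isLocallyHolder_of_dyadic (f := fun s => V s ω) (g := fun t => g ω t) hγ0
        (hG ω hω γ hγ0 hγ) (hg ω hω)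
      simpa only [hZ, Set.indicator_of_mem hω] using this
    · intro T
      refine ⟨0, fun s _ t _ => ?_⟩
      simp [hZ, hω]

end Kolmogorov

/-! ### The derivatives of the local time of fractional Brownian motion -/

theorem lemma5p3 {Ω : Type*} [MeasurableSpace Ω] (P : Measure Ω) [IsProbabilityMeasure P]
    (H : ℝ) (X : ℝ≥0 → Ω → ℝ) (hX : IsFractionalBrownianMotion H X P)
    (ℓ : ℕ) (hH0 : 0 < H) (hH : H < 1 / (2 * (ℓ : ℝ) + 1)) :
    -- `L k t x` is the derivative of order `k` of the local time up to time `t`, at the point `x`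
    ∃ L : ℕ → ℝ≥0 → ℝ → Ω → ℝ,
      -- existence as a limit in `L²(Ω)`
      (∀ k ≤ ℓ, ∀ (t : ℝ≥0) (x : ℝ),
        TendstoInL2 P (fun ε : ℝ => localTimeDerivApprox X k ε t x) (𝓝[>] 0) (L k t x)) ∧
      -- Fourier representation
      (∀ (t : ℝ≥0) (x : ℝ),
        TendstoInL2 P (fun N : ℝ => localTimeDerivFourier X ℓ N t x) atTop
          (fun ω => (L ℓ t x ω : ℂ))) ∧
      -- spatial derivative in `L²(Ω)`
      (1 ≤ ℓ → ∀ (t : ℝ≥0) (x : ℝ),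
        TendstoInL2 P
          (fun (h : ℝ) (ω : Ω) => 1 / h * (L (ℓ - 1) t (x + h) ω - L (ℓ - 1) t x ω)) (𝓝[≠] 0)
          (fun ω => -L ℓ t x ω)) ∧
      -- moments of the increments in time
      (∀ (x p : ℝ), 1 < p → ∃ C : ℝ, ∀ u v : ℝ≥0, u < v →
        eLpNorm (fun ω => L ℓ v x ω - L ℓ u x ω) (ENNReal.ofReal (2 * p)) P ^ (2 * p) ≤
          ENNReal.ofReal (C * |(u : ℝ) - (v : ℝ)| ^ (2 * p * (1 - H * ((ℓ : ℝ) + 1))))) ∧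
      -- Hölder modification in time
      (∀ x : ℝ, ∃ Z : ℝ≥0 → Ω → ℝ, IsModificationOf P Z (fun t => L ℓ t x) ∧
        ∀ γ : ℝ≥0, 0 < γ → (γ : ℝ) < 1 - H * ((ℓ : ℝ) + 1) →
          ∀ ω, IsLocallyHolder γ (fun t => Z t ω)) := by
  have hℓ : ∀ k ≤ ℓ, H * (2 * (k : ℝ) + 1) < 1 := by
    intro k hk
    have h1 : (k : ℝ) ≤ ℓ := by exact_mod_cast hk
    have h2 : H * (2 * (ℓ : ℝ) + 1) < 1 := by rwa [lt_div_iff₀ (by positivity)] at hH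
    nlinarith
  obtain ⟨Y, hY⟩ := hX.exists_isMeasurableVersion
  have hex : ∀ k, k ≤ ℓ → ∀ (t : ℝ≥0) (x : ℝ), ∃ Z : Ω → ℝ,
      TendstoInL2 P (fun ε : ℝ => localTimeDerivApprox X k ε t x) (𝓝[>] 0) Z ∧
      TendstoInL2 P (fun N : ℝ => localTimeDerivFourier X k N t x) atTop (fun ω => (Z ω : ℂ)) :=
    fun k hk t x => exists_localTimeDeriv hX hY hH0 (hℓ k hk) t x
  choose! L hL using hex
  have hβ : 0 < 1 - H * ((ℓ : ℝ) + 1) := by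
    have h1 := hℓ ℓ le_rfl
    have h2 : (0 : ℝ) ≤ ℓ := Nat.cast_nonneg _
    nlinarith
  have hmom : ∀ x p : ℝ, 1 < p → ∃ C : ℝ, ∀ u v : ℝ≥0, u < v →
      eLpNorm (fun ω => L ℓ v x ω - L ℓ u x ω) (ENNReal.ofReal (2 * p)) P ^ (2 * p) ≤
        ENNReal.ofReal (C * |(u : ℝ) - (v : ℝ)| ^ (2 * p * (1 - H * ((ℓ : ℝ) + 1)))) :=
    fun x p hp => exists_eLpNorm_increment_rpow_le hX hY hH0 (hℓ ℓ le_rfl) x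
      (Z := fun t => L ℓ t x) (fun t => (hL ℓ le_rfl t x).2) hp
  refine ⟨L, fun k hk t x => (hL k hk t x).1, fun t x => (hL ℓ le_rfl t x).2, fun hℓ1 t x => ?_,
    hmom, fun x => ?_⟩
  · obtain ⟨k, rfl⟩ := Nat.exists_eq_add_of_le' hℓ1
    exact tendstoInL2_difference_quotient hX hY hH0 (hℓ _ le_rfl) t x
      (fun y => (hL k (Nat.le_succ k) t y).2) (hL (k + 1) le_rfl t x).2
  · exact exists_holder_modification hβ
      (fun t => (hL ℓ le_rfl t x).1.2.1.aestronglyMeasurable.aemeasurable) (hmom x)
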